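/- Let $n\ge 0$ and let $\pi\in S_{n+1}$ be of the form $\pi=1\pi'$, i.e. $\pi(1)=1$, where $\pi'=\pi(2)\cdots\pi(n+1)$ is a dominant permutation of $\{2,\dots,n+1\}$: after relabelling $\pi'$ order-preservingly as a permutation $w$ of $\{1,\dots,n\}$, its diagram $\{(i,j): j<w(i),\ i<w^{-1}(j)\}$ is the Young diagram of a (possibly empty) partition, placed in the north-west corner. A pipe dream of $\pi$ is a tiling of the $(n+1)\times(n+1)$ matrix by crosses and elbows (an elbow tile joins its top edge to its left edge and its right edge to its bottom edge) in which all crosses $(i,j)$ satisfy $i+j\le n+1$ and such that, numbering the strands $1,\dots,n+1$ along the top and following them while ignoring second crossings of the same two strands, they come out on the left and read $\pi$ from top to bottom; it is reduced if no two strands cross twice. The weight $\mathrm{wt}(P)$ of a pipe dream $P$ is $\prod t_i$ over its crosses $(i,j)$. The Grothendieck and Schubert polynomials of $\pi$ are $$\mathfrak G_\pi(t_1,\dots,t_n)=\sum_{P \text{ pipe dream of } \pi}\mathrm{wt}(P),\qquad \mathfrak S_\pi(t_1,\dots,t_n)=\sum_{P\text{ reduced pipe dream of }\pi}\mathrm{wt}(P).$$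 For $f=\sum_\alpha c_\alpha \mathbf t^\alpha$ with $\alpha\in\mathbb Z_{\ge0}^n$, let $\mathrm{Newton}(f)\subset\mathbb R^n$ be the convex hull of $\{\alpha: c_\alpha\ne0\}$; $f$ has polytopal support if the integer points of $\mathrm{Newton}(f)$ are exactly the $\alpha$ with $c_\alpha\neq 0$. A generalized permutahedron is a set of the form $$\Big\{\mathbf t\in\mathbb R^n:\ \sum_{i\in I}t_i\ge z_I \text{ for all } I\subsetneq\{1,\dots,n\},\ \sum_{i=1}^n t_i=z_{\{1,\dots,n\}}\Big\}$$ with real numbers $z_I$ $(I\subseteq\{1,\dots,n\})$ such that $z_\emptyset=0$ and $z_{I\cup J}+z_{I\cap J}\ge z_I+z_J$ for all $I,J$. Then: 1. $\mathfrak G_\pi$ has polytopal support, and the Newton polytope of each nonzero homogeneous component of $\mathfrak G_\pi$ is a generalized permutahedron. 2. $\mathfrak S_\pi$ has polytopal support, $\mathrm{Newton}(\mathfrak S_\pi)$ is a generalized permutahedron, and $\mathfrak S_\pi$ is the integer-point transform of its Newton polytope: $\mathfrak S_\pi(\mathbf t)=\sum_{p\in \mathrm{Newton}(\mathfrak S_\pi)\cap\mathbb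 Z^n}\mathbf t^{p}$. -/

import Mathlib

/-- The exponent vectors of the monomials of `f` with nonzero coefficient, as points of `ℝⁿ`. -/
def exponentVectors {n : ℕ} (f : MvPolynomial (Fin n) ℤ) : Set (Fin n → ℝ) :=
  {x | ∃ α : Fin n →₀ ℕ, f.coeff α ≠ 0 ∧ x = fun i => (α i : ℝ)}

/-- The Newton polytope of a polynomial. -/
def newtonPolytope {n : ℕ} (f : MvPolynomial (Fin n) ℤ) : Set (Fin n → ℝ) :=
  convexHull ℝ (exponentVectors f)

/-- The integer points of a subset of `ℝⁿ`. -/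
def integerPoints {n : ℕ} (P : Set (Fin n → ℝ)) : Set (Fin n → ℤ) :=
  {p | (fun i => (p i : ℝ)) ∈ P}

/-- Polytopal support: the integer points of the Newton polytope are exactly the exponent vectors
of the monomials that appear in `f` with nonzero coefficient. -/
def HasPolytopalSupport {n : ℕ} (f : MvPolynomial (Fin n) ℤ) : Prop :=
  integerPoints (newtonPolytope f) =
    {p | ∃ α : Fin n →₀ ℕ, f.coeff α ≠ 0 ∧ p = fun i => (α i : ℤ)}

/-- The generalized permutahedron with parameters `z`. -/
def permutahedronOf {n : ℕ} (z : Finset (Fin n) → ℝ) : Set (Fin n → ℝ) :=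
  {t | (∀ I : Finset (Fin n), I ≠ Finset.univ → z I ≤ ∑ i ∈ I, t i) ∧
    ∑ i, t i = z Finset.univ}

/-- `P` is a generalized permutahedron: it is `permutahedronOf z` for some supermodular
parameters `z` with `z ∅ = 0`. -/
def IsGeneralizedPermutahedron {n : ℕ} (P : Set (Fin n → ℝ)) : Prop :=
  ∃ z : Finset (Fin n) → ℝ, z ∅ = 0 ∧
    (∀ I J : Finset (Fin n), z I + z J ≤ z (I ∪ J) + z (I ∩ J)) ∧
    P = permutahedronOf z

/-- A polynomial regarded as a Laurent polynomial, with exponents in `ℤⁿ`. -/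
noncomputable def toLaurent {n : ℕ} (f : MvPolynomial (Fin n) ℤ) :
    AddMonoidAlgebra ℤ (Fin n → ℤ) :=
  ∑ α ∈ f.support, AddMonoidAlgebra.single (fun i => (α i : ℤ)) (f.coeff α)

/-- `f` is the integer-point transform of `P`: the set `P ∩ ℤⁿ` is finite and
`f = ∑_{p ∈ P ∩ ℤⁿ} x ^ p`. -/
def IsIntegerPointTransform {n : ℕ} (f : MvPolynomial (Fin n) ℤ) (P : Set (Fin n → ℝ)) : Prop :=
  ∃ h : (integerPoints P).Finite,
    toLaurent f = ∑ p ∈ h.toFinset, AddMonoidAlgebra.single p (1 : ℤ)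

/-- The Rothe diagram `{(i, w j) : i < j, w i > w j}` of a permutation, in matrix coordinates. -/
def rotheDiagram {n : ℕ} (w : Equiv.Perm (Fin n)) : Set (Fin n × Fin n) :=
  {p | p.2 < w p.1 ∧ p.1 < w.symm p.2}

/-- A permutation is dominant if its diagram is the Young diagram of a (possibly empty) partition,
justified to the north-west corner. -/
def IsDominantPerm {n : ℕ} (w : Equiv.Perm (Fin n)) : Prop :=
  IsLowerSet (rotheDiagram w)

/-- The tiles of an `(n+1) × (n+1)` matrix (rows and columns numbered from `0`) strictly
north-west of the antidiagonal: those that may be crosses in a pipe dream. -/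
abbrev Tile (n : ℕ) : Type :=
  {p : Fin n × Fin n // (p.1 : ℕ) + (p.2 : ℕ) < n}

/-- The tiles, row by row from top to bottom, each row from right to left. -/
def tileList (n : ℕ) : List (Tile n) :=
  (List.finRange n).flatMap fun (i : Fin n) =>
    (List.finRange n).reverse.filterMap fun (j : Fin n) =>
      if h : (i : ℕ) + (j : ℕ) < n then some ⟨(i, j), h⟩ else none

/-- The cross tiles of a tiling with set of crosses `D`, in the order in which they are met. -/
def crossList {n : ℕ} (D : Finset (Tile n)) : List (Tile n) :=
  (tileList n).filter fun c => c ∈ D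

/-- Cut the matrix along the lattice path that separates the tiles already passed from the others.
The strands meet this path in `n + 1` edges, numbered from the south-west end to the north-east
end; `σ k` is the strand at edge `k`. The top and the right edge of the tile `c = (i, j)` are the
edges `topEdge c = i + j` and `rightEdge c = i + j + 1`; once `c` has been passed these are the
numbers of its left and its bottom edge. -/
def topEdge {n : ℕ} (c : Tile n) : Fin (n + 1) :=
  Fin.castSucc ⟨(c.1.1 : ℕ) + (c.1.2 : ℕ), c.2⟩

/-- See `topEdge`. -/
def rightEdge {n : ℕ} (c : Tile n) : Fin (n + 1) :=
  Fin.succ ⟨(c.1.1 : ℕ) + (c.1.2 : ℕ), c.2⟩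

/-- Passing an elbow leaves `σ` unchanged (top is joined to left and right to bottom). At a cross
the two strands are interchanged if they have not crossed before, that is, if they are still in
increasing order; a second crossing of the same two strands is ignored. -/
def passCross {n : ℕ} (σ : Equiv.Perm (Fin (n + 1))) (c : Tile n) : Equiv.Perm (Fin (n + 1)) :=
  if σ (topEdge c) < σ (rightEdge c) then σ * Equiv.swap (topEdge c) (rightEdge c) else σ

/-- The permutation of a tiling: the strands are numbered `0, …, n` along the top and followed
through all tiles; the value at `i` is the strand that comes out on the left in row `i`. -/
def strandPerm {n : ℕ} (D : Finset (Tile n)) : Equiv.Perm (Fin (n + 1)) :=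
  (crossList D).foldl passCross 1

/-- Starting from `σ`, the strands that meet at each cross of the list have not crossed before. -/
def NoSecondCrossing {n : ℕ} : List (Tile n) → Equiv.Perm (Fin (n + 1)) → Prop
  | [], _ => True
  | c :: l, σ => σ (topEdge c) < σ (rightEdge c) ∧ NoSecondCrossing l (passCross σ c)

/-- A tiling is reduced if no two strands cross twice. -/
def IsReducedTiling {n : ℕ} (D : Finset (Tile n)) : Prop :=
  NoSecondCrossing (crossList D) 1

/-- The pipe dreams of `w`, given by their sets of crosses. -/
def pipeDreams {n : ℕ} (w : Equiv.Perm (Fin (n + 1))) : Finset (Finset (Tile n)) :=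
  Finset.univ.filter fun D => strandPerm D = w

open scoped Classical in
/-- The reduced pipe dreams of `w`. -/
noncomputable def reducedPipeDreams {n : ℕ} (w : Equiv.Perm (Fin (n + 1))) :
    Finset (Finset (Tile n)) :=
  (pipeDreams w).filter fun D => IsReducedTiling D

/-- The weight of a pipe dream: the product of `t_i` over its crosses `(i, j)`. -/
noncomputable def pipeWeight {n : ℕ} (D : Finset (Tile n)) : MvPolynomial (Fin n) ℤ :=
  ∏ c ∈ D, MvPolynomial.X c.1.1

/-- The Grothendieck polynomial. -/
noncomputable def grothendieckPoly {n : ℕ} (w : Equiv.Perm (Fin (n + 1))) :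
    MvPolynomial (Fin n) ℤ :=
  ∑ D ∈ pipeDreams w, pipeWeight D

/-- The Schubert polynomial. -/
noncomputable def schubertPoly {n : ℕ} (w : Equiv.Perm (Fin (n + 1))) :
    MvPolynomial (Fin n) ℤ :=
  ∑ D ∈ reducedPipeDreams w, pipeWeight D

/-!
The pipe dreams of `1π'` form one coefficient of a product of factors `1 + t_i u_j` in the `0`-Hecke
algebra. Divided differences turn this into an explicit formula: with `λ` the code of the dominant
permutation `π'`, a partition, `𝔊` is a sum over "carries" that pass from each variable to the
next, each carry being at most what the preceding one leaves. Such a sum has no cancellation, so an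
exponent vector occurs if and only if a sequence of carries realizes it, and eliminating the carries
leaves the inequalities `t_i ≤ λ_{i-1}` together with upper bounds on the prefix sums
`t_0 + ⋯ + t_{k-1}` in terms of the degree. These inequalities cut out a convex region, which gives
polytopal support. On a plane of constant degree, a set of lattice points given by a box and bounds
on prefix sums satisfies the symmetric exchange axiom, so its convex hull is a generalized
permutahedron. `𝔖` is the component of lowest degree of `𝔊`, where at most one sequence of carries
is possible.
-/

/-- The least sum over the coordinates in `I` of a vector in `A`: the parameters of the generalized
permutahedron spanned by `A`. -/
noncomputable def minSum {ι : Type*} (A : Finset (ι → ℤ)) (hA : A.Nonempty) (I : Finset ι) : ℝ :=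
  A.inf' hA fun α => ∑ i ∈ I, (α i : ℝ)

theorem minSum_le {ι : Type*} {A : Finset (ι → ℤ)} (hA : A.Nonempty) (I : Finset ι) {α : ι → ℤ}
    (hα : α ∈ A) : minSum A hA I ≤ ∑ i ∈ I, (α i : ℝ) :=
  Finset.inf'_le (fun α : ι → ℤ => ∑ i ∈ I, (α i : ℝ)) hα

theorem minSum_eq {ι : Type*} {A : Finset (ι → ℤ)} (hA : A.Nonempty) {I : Finset ι} {α : ι → ℤ}
    (hα : α ∈ A) (hmin : ∀ β ∈ A, ∑ i ∈ I, α i ≤ ∑ i ∈ I, β i) :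
    minSum A hA I = ∑ i ∈ I, (α i : ℝ) :=
  (minSum_le hA I hα).antisymm (Finset.le_inf' _ _ fun β hβ => mod_cast hmin β hβ)

section SymmetricExchange

variable {ι : Type*} [DecidableEq ι]

/-- The vector obtained from `α` by moving one unit from coordinate `i` to coordinate `j`. -/
def moveUnit (α : ι → ℤ) (i j : ι) : ι → ℤ :=
  α - Pi.single i 1 + Pi.single j 1

theorem sum_moveUnit (I : Finset ι) (α : ι → ℤ) (i j : ι) :
    ∑ l ∈ I, moveUnit α i j l =
      ∑ l ∈ I, α l - (if i ∈ I then 1 else 0) + (if j ∈ I then 1 else 0) := by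
  simp [moveUnit, Finset.sum_add_distrib, Finset.sum_sub_distrib, Pi.single_apply]

theorem sum_mul_moveUnit [Fintype ι] (w : ι → ℝ) (α : ι → ℤ) (i j : ι) :
    ∑ l, w l * (moveUnit α i j l : ℝ) = ∑ l, w l * (α l : ℝ) - w i + w j := by
  simp [moveUnit, Pi.single_apply, mul_add, mul_sub, Finset.sum_add_distrib,
    Finset.sum_sub_distrib]

theorem sum_abs_sub_moveUnit_lt [Fintype ι] {α β : ι → ℤ} {i j : ι} (hi : β i < α i)
    (hj : α j < β j) : ∑ l, |α l - moveUnit β j i l| < ∑ l, |α l - β l| := by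
  have hij : i ≠ j := by rintro rfl; omega
  refine Finset.sum_lt_sum (fun l _ => ?_) ⟨i, Finset.mem_univ i, ?_⟩
  · rcases eq_or_ne l i with rfl | hli
    · simp only [moveUnit, Pi.add_apply, Pi.sub_apply, Pi.single_eq_same,
        Pi.single_eq_of_ne hij]
      grind
    rcases eq_or_ne l j with rfl | hlj
    · simp only [moveUnit, Pi.add_apply, Pi.sub_apply, Pi.single_eq_same,
        Pi.single_eq_of_ne hli]
      grind
    · simp [moveUnit, hli, hlj]
  · simp only [moveUnit, Pi.add_apply, Pi.sub_apply, Pi.single_eq_same, Pi.single_eq_of_ne hij]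
    grind

/-- The symmetric exchange property, which defines M-convex sets. -/
def SymmetricExchange (A : Finset (ι → ℤ)) : Prop :=
  ∀ α ∈ A, ∀ β ∈ A, ∀ i, β i < α i →
    ∃ j, α j < β j ∧ moveUnit α i j ∈ A ∧ moveUnit β j i ∈ A

theorem SymmetricExchange.sum_superlevel_le [Fintype ι] {A : Finset (ι → ℤ)}
    (hA : SymmetricExchange A) {w : ι → ℝ} {α : ι → ℤ} (hα : α ∈ A)
    (hmin : ∀ β ∈ A, ∑ i, w i * (α i : ℝ) ≤ ∑ i, w i * (β i : ℝ)) (c : ℝ) :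
    ∀ β ∈ A, ∑ i with c ≤ w i, α i ≤ ∑ i with c ≤ w i, β i := by
  by_contra! ⟨β₀, hβ₀, hlt₀⟩
  -- Among the violators, take one at minimal `ℓ¹`-distance from `α`.
  obtain ⟨β, hβ, hclosest⟩ := Finset.exists_min_image
    (A.filter fun β => ∑ i with c ≤ w i, β i < ∑ i with c ≤ w i, α i)
    (fun β => ∑ i, |α i - β i|) ⟨β₀, by simp [hβ₀, hlt₀]⟩
  simp only [Finset.mem_filter] at hβ hclosest
  obtain ⟨hβA, hlt⟩ := hβ
  obtain ⟨i, hic, hi⟩ := Finset.exists_lt_of_sum_lt hlt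
  obtain ⟨j, hj, hα', hβ'⟩ := hA α hα β hβA i hi
  have hwij : w i ≤ w j := by
    have := hmin _ hα'
    rw [sum_mul_moveUnit] at this
    linarith
  have hjc : c ≤ w j := (Finset.mem_filter.1 hic).2.trans hwij
  refine (sum_abs_sub_moveUnit_lt hi hj).not_ge (hclosest _ ⟨hβ', ?_⟩)
  rw [sum_moveUnit, if_pos hic, if_pos (by simpa using hjc)]
  simpa using hlt

theorem SymmetricExchange.minSum_add_le [Finite ι] {A : Finset (ι → ℤ)}
    (hex : SymmetricExchange A) (hA : A.Nonempty) (I J : Finset ι) :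
    minSum A hA I + minSum A hA J ≤ minSum A hA (I ∪ J) + minSum A hA (I ∩ J) := by
  have := Fintype.ofFinite ι
  let w : ι → ℝ := fun i => (if i ∈ I then 1 else 0) + (if i ∈ J then 1 else 0)
  obtain ⟨α, hα, hmin⟩ := Finset.exists_min_image A (fun α => ∑ i, w i * (α i : ℝ)) hA
  have hlevel := hex.sum_superlevel_le hα hmin
  have hunion : (Finset.univ.filter fun i => 1 ≤ w i) = I ∪ J := by
    ext i
    by_cases hI : i ∈ I <;> by_cases hJ : i ∈ J <;> simp [w, hI, hJ]
  have hinter : (Finset.univ.filter fun i => 2 ≤ w i) = I ∩ J := by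
    ext i
    by_cases hI : i ∈ I <;> by_cases hJ : i ∈ J <;> norm_num [w, hI, hJ]
  rw [minSum_eq hA (I := I ∪ J) hα (by simpa only [hunion] using hlevel 1),
    minSum_eq hA (I := I ∩ J) hα (by simpa only [hinter] using hlevel 2), Finset.sum_union_inter]
  exact add_le_add (minSum_le hA I hα) (minSum_le hA J hα)

end SymmetricExchange

theorem sum_mul_nonneg_of_superlevel_of_pos {ι : Type*} (s : Finset ι) (w d : ι → ℝ)
    (hw : ∀ i ∈ s, 0 < w i) (hd : ∀ c > 0, 0 ≤ ∑ i ∈ s with c ≤ w i, d i) :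
    0 ≤ ∑ i ∈ s, w i * d i := by
  induction s using Finset.strongInduction generalizing w with
  | H s ih =>
    rcases s.eq_empty_or_nonempty with rfl | hs
    · simp
    obtain ⟨a, ha, hmin⟩ := s.exists_min_image w hs
    have hall : 0 ≤ ∑ i ∈ s, d i := by
      simpa [Finset.filter_true_of_mem hmin] using hd _ (hw a ha)
    have hrest : 0 ≤ ∑ i ∈ s with w a < w i, (w i - w a) * d i := by
      refine ih _ (Finset.filter_ssubset.2 ⟨a, ha, lt_irrefl (w a)⟩) (fun i => w i - w a)
        (fun i hi => sub_pos.2 (Finset.mem_filter.1 hi).2) fun c hc => ?_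
      rw [Finset.filter_filter]
      convert hd (c + w a) (add_pos hc (hw a ha)) using 3
      grind
    have hsplit : ∑ i ∈ s, w i * d i =
        w a * ∑ i ∈ s, d i + ∑ i ∈ s with w a < w i, (w i - w a) * d i := by
      rw [Finset.sum_filter_of_ne, Finset.mul_sum, ← Finset.sum_add_distrib]
      · exact Finset.sum_congr rfl fun i _ => by ring
      · intro i hi hne
        exact (hmin i hi).lt_of_ne (sub_ne_zero.1 (left_ne_zero_of_mul hne)).symm
    rw [hsplit]
    exact add_nonneg (mul_nonneg (hw a ha).le hall) hrest

theorem sum_mul_nonneg_of_superlevel {ι : Type*} [Fintype ι] (w d : ι → ℝ)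
    (hsum : ∑ i, d i = 0) (hd : ∀ c, 0 ≤ ∑ i with c ≤ w i, d i) : 0 ≤ ∑ i, w i * d i := by
  obtain ⟨m, hm⟩ := (Set.finite_range w).bddBelow
  have hpos := sum_mul_nonneg_of_superlevel_of_pos Finset.univ (fun i => w i - (m - 1)) d
    (fun i _ => by linarith [hm ⟨i, rfl⟩])
    fun c _ => by simpa only [le_sub_iff_add_le] using hd (c + (m - 1))
  have hshift : ∑ i, (w i - (m - 1)) * d i = ∑ i, w i * d i - (m - 1) * ∑ i, d i := by
    rw [Finset.mul_sum, ← Finset.sum_sub_distrib]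
    exact Finset.sum_congr rfl fun i _ => sub_mul _ _ _
  rwa [hshift, hsum, mul_zero, sub_zero] at hpos

section GeneralizedPermutahedron

variable {n : ℕ}

theorem convex_permutahedronOf (z : Finset (Fin n) → ℝ) : Convex ℝ (permutahedronOf z) := by
  have hlinear (I : Finset (Fin n)) : IsLinearMap ℝ fun t : Fin n → ℝ => ∑ i ∈ I, t i :=
    ⟨fun x y => by simp [Finset.sum_add_distrib], fun a x => by simp [Finset.mul_sum]⟩
  have hhalfspaces : permutahedronOf z =
      (⋂ (I : Finset (Fin n)) (_ : I ≠ Finset.univ), {t | z I ≤ ∑ i ∈ I, t i}) ∩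
        {t | ∑ i, t i = z Finset.univ} := by
    ext t
    simp [permutahedronOf]
  rw [hhalfspaces]
  exact (convex_iInter₂ fun I _ => convex_halfSpace_ge (hlinear I) _).inter
    (convex_hyperplane (hlinear _) _)

/-- The convex hull in `ℝⁿ` of a finite set of integer vectors. -/
def integerHull (A : Finset (Fin n → ℤ)) : Set (Fin n → ℝ) :=
  convexHull ℝ ((fun (α : Fin n → ℤ) (i : Fin n) => (α i : ℝ)) '' (A : Set (Fin n → ℤ)))

theorem integerHull_subset_permutahedronOf {A : Finset (Fin n → ℤ)} (hA : A.Nonempty) {s : ℤ}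
    (hs : ∀ α ∈ A, ∑ i, α i = s) :
    integerHull A ⊆ permutahedronOf (minSum A hA) := by
  refine convexHull_min ?_ (convex_permutahedronOf _)
  rintro _ ⟨α, hα, rfl⟩
  refine ⟨fun I _ => minSum_le hA I hα, ?_⟩
  exact (minSum_eq hA hα fun β hβ => (hs α hα).trans_le (hs β hβ).ge).symm

theorem exists_forall_eq_sum_mul (f : (Fin n → ℝ) →L[ℝ] ℝ) :
    ∃ w : Fin n → ℝ, ∀ x, f x = ∑ i, w i * x i := by
  refine ⟨fun i => f (Pi.single i 1), fun x => ?_⟩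
  conv_lhs => rw [pi_eq_sum_univ' x, map_sum]
  exact Finset.sum_congr rfl fun i _ => by rw [map_smul, smul_eq_mul, mul_comm]

theorem SymmetricExchange.permutahedronOf_subset_integerHull {A : Finset (Fin n → ℤ)}
    (hex : SymmetricExchange A) (hA : A.Nonempty) {s : ℤ} (hs : ∀ α ∈ A, ∑ i, α i = s) :
    permutahedronOf (minSum A hA) ⊆ integerHull A := by
  intro t ht
  by_contra hnot
  obtain ⟨f, u, hft, hfA⟩ := geometric_hahn_banach_point_closed (convex_convexHull ℝ _)
    ((A.finite_toSet.image _).isClosed_convexHull (𝕜 := ℝ)) hnot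
  obtain ⟨w, hw⟩ := exists_forall_eq_sum_mul f
  obtain ⟨α, hα, hmin⟩ := Finset.exists_min_image A (fun α => ∑ i, w i * (α i : ℝ)) hA
  have hminSum : ∀ I : Finset (Fin n), (∀ β ∈ A, ∑ i ∈ I, α i ≤ ∑ i ∈ I, β i) →
      ∑ i ∈ I, (α i : ℝ) ≤ ∑ i ∈ I, t i := fun I hI => by
    rw [← minSum_eq hA hα hI]
    rcases eq_or_ne I Finset.univ with rfl | hne
    exacts [ht.2.ge, ht.1 I hne]
  have hsum : ∑ i, (t i - α i) = 0 := by
    rw [Finset.sum_sub_distrib, ht.2,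
      minSum_eq hA hα fun β hβ => (hs α hα).trans_le (hs β hβ).ge, sub_self]
  have hnonneg : 0 ≤ ∑ i, w i * (t i - α i) :=
    sum_mul_nonneg_of_superlevel w _ hsum fun c => by
      rw [Finset.sum_sub_distrib, sub_nonneg]
      exact hminSum _ (hex.sum_superlevel_le hα hmin c)
  have hαt : f (fun i => (α i : ℝ)) ≤ f t := by
    rw [hw, hw, ← sub_nonneg, ← Finset.sum_sub_distrib]
    simpa only [mul_sub] using hnonneg
  exact (hft.trans (hfA _ (subset_convexHull ℝ _ ⟨α, hα, rfl⟩))).not_ge hαt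

theorem SymmetricExchange.isGeneralizedPermutahedron {A : Finset (Fin n → ℤ)}
    (hex : SymmetricExchange A) (hA : A.Nonempty) {s : ℤ} (hs : ∀ α ∈ A, ∑ i, α i = s) :
    IsGeneralizedPermutahedron (integerHull A) := by
  refine ⟨minSum A hA, ?_, hex.minSum_add_le hA,
    (integerHull_subset_permutahedronOf hA hs).antisymm
      (hex.permutahedronOf_subset_integerHull hA hs)⟩
  obtain ⟨α, hα⟩ := hA
  simp [minSum_eq ⟨α, hα⟩ hα (I := ∅) (by simp)]

end GeneralizedPermutahedron

section PrefixSum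

variable {n : ℕ} {M : Type*} [AddCommMonoid M]

/-- The sum of the first `k` coordinates of `γ`; for `k ≥ n` this is the sum of all of them. -/
def prefixSum (γ : Fin n → M) (k : ℕ) : M :=
  ∑ l with l.val < k, γ l

@[simp]
theorem prefixSum_zero (γ : Fin n → M) : prefixSum γ 0 = 0 := by
  simp [prefixSum]

theorem prefixSum_succ (γ : Fin n → M) (l : Fin n) :
    prefixSum γ (l + 1) = prefixSum γ l + γ l := by
  have hinsert : (Finset.univ.filter fun j : Fin n => j.val < l + 1) =
      insert l (Finset.univ.filter fun j : Fin n => j.val < l) := by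
    ext j
    simp only [Finset.mem_filter, Finset.mem_univ, true_and, Finset.mem_insert, Fin.ext_iff]
    omega
  rw [prefixSum, hinsert, Finset.sum_insert (by simp), add_comm, prefixSum]

theorem prefixSum_self (γ : Fin n → M) : prefixSum γ n = ∑ i, γ i := by
  simp [prefixSum]

theorem prefixSum_eq_sum_range (f : ℕ → M) {k : ℕ} (hk : k ≤ n) :
    prefixSum (fun i : Fin n => f i) k = ∑ j ∈ Finset.range k, f j := by
  induction k with
  | zero => simp
  | succ k ih =>
    rw [Finset.sum_range_succ, ← ih (by omega), ← prefixSum_succ (fun i : Fin n => f i) ⟨k, hk⟩]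

end PrefixSum

theorem exists_last_of_not {p : ℕ → Prop} {m : ℕ} (h0 : p 0) (hm : ¬p m) :
    ∃ j < m, p j ∧ ∀ k, j < k → k ≤ m → ¬p k := by
  induction m with
  | zero => exact absurd h0 hm
  | succ m ih =>
    by_cases hpm : p m
    · refine ⟨m, m.lt_succ_self, hpm, fun k hk hkm => ?_⟩
      rwa [hkm.antisymm hk]
    · obtain ⟨j, hj, hpj, hlast⟩ := ih hpm
      refine ⟨j, hj.trans m.lt_succ_self, hpj, fun k hjk hkm => ?_⟩
      rcases hkm.eq_or_lt with rfl | hlt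
      exacts [hm, hlast k hjk (Nat.le_of_lt_succ hlt)]

theorem exists_succ_first_of_not {p : ℕ → Prop} {i m : ℕ} (him : i ≤ m) (hi : ¬p i) (hm : p m) :
    ∃ j < m, i ≤ j ∧ p (j + 1) ∧ ∀ k, i ≤ k → k ≤ j → ¬p k := by
  classical
  have hlt : i < m := him.lt_of_ne fun h => hi (h ▸ hm)
  obtain ⟨m, rfl⟩ : ∃ l, m = l + 1 := ⟨m - 1, by omega⟩
  have hex : ∃ j, i ≤ j ∧ p (j + 1) := ⟨m, Nat.le_of_lt_succ hlt, hm⟩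
  obtain ⟨hij, hpj⟩ := Nat.find_spec hex
  refine ⟨Nat.find hex, Nat.lt_succ_of_le (Nat.find_min' hex ⟨Nat.le_of_lt_succ hlt, hm⟩), hij,
    hpj, fun k hik hkj hpk => ?_⟩
  rcases hik.eq_or_lt with rfl | hik
  · exact hi hpk
  obtain ⟨l, rfl⟩ : ∃ l, k = l + 1 := ⟨k - 1, by omega⟩
  exact Nat.find_min hex hkj ⟨Nat.le_of_lt_succ hik, hpk⟩

section BoxChain

variable {n : ℕ}

/-- Membership in the polyhedron of vectors of coordinate sum `s` whose coordinates are bounded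
above by `u` and whose prefix sums are bounded above by `c`. -/
structure MemBoxChain (u : Fin n → ℤ) (c : ℕ → ℤ) (s : ℤ) (α : Fin n → ℤ) : Prop where
  le_box (i : Fin n) : α i ≤ u i
  prefixSum_le {k : ℕ} (hk : k ≤ n) : prefixSum α k ≤ c k
  sum_eq : ∑ i, α i = s

variable {u : Fin n → ℤ} {c : ℕ → ℤ} {s : ℤ}

theorem MemBoxChain.memBoxChain_moveUnit {α : Fin n → ℤ} (hα : MemBoxChain u c s α) {i j : Fin n}
    (hij : i ≠ j) (hj : α j < u j)
    (hslack : ∀ k : ℕ, j.val < k → k ≤ i.val → prefixSum α k < c k) :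
    MemBoxChain u c s (moveUnit α i j) where
  le_box l := by
    have := hα.le_box l
    rcases eq_or_ne l j with rfl | hlj
    · simp [moveUnit, hij.symm]; omega
    · rcases eq_or_ne l i with rfl | hli
      · simp [moveUnit, hlj]; omega
      · simpa [moveUnit, hlj, hli] using this
  prefixSum_le {k} hk := by
    have hle := hα.prefixSum_le hk
    have hlt := hslack k
    simp only [prefixSum, sum_moveUnit, Finset.mem_filter, Finset.mem_univ, true_and] at hle hlt ⊢
    split_ifs <;> omega
  sum_eq := by simp [sum_moveUnit, hα.sum_eq]

/-- If the prefix sum of `α` before `i` is the smaller one, the unit goes to the last coordinate on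
the left of `i` at which `β` overtakes `α`; otherwise `α` is ahead just after `i`, and the unit goes
to the first coordinate on the right at which `β` has caught up. -/
theorem MemBoxChain.exists_exchange {α β : Fin n → ℤ} (hα : MemBoxChain u c s α)
    (hβ : MemBoxChain u c s β) {i : Fin n} (hi : β i < α i) :
    ∃ j, α j < β j ∧ MemBoxChain u c s (moveUnit α i j) ∧
      MemBoxChain u c s (moveUnit β j i) := by
  rcases lt_or_ge (prefixSum α i) (prefixSum β i) with hlt | hge
  · obtain ⟨j, hji, hj, hbetween⟩ :=
      exists_last_of_not (p := fun k => prefixSum β k ≤ prefixSum α k) (by simp) hlt.not_ge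
    obtain ⟨j, rfl⟩ : ∃ l : Fin n, l.val = j := ⟨⟨j, hji.trans i.2⟩, rfl⟩
    have hjlt : α j < β j := by
      have := hbetween (j + 1) (Nat.lt_succ_self _) hji
      rw [prefixSum_succ, prefixSum_succ] at this
      omega
    refine ⟨j, hjlt,
      hα.memBoxChain_moveUnit (by omega) (hjlt.trans_le (hβ.le_box j)) fun k hjk hki => ?_,
      hβ.memBoxChain_moveUnit (by omega) (hi.trans_le (hα.le_box i)) fun k hik hkj => by omega⟩
    exact (not_le.1 (hbetween k hjk hki)).trans_le (hβ.prefixSum_le (hki.trans i.2.le))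
  · have hlt : ¬prefixSum α (i + 1) ≤ prefixSum β (i + 1) := by
      rw [prefixSum_succ, prefixSum_succ]
      omega
    obtain ⟨j, hjn, hij, hj, hbetween⟩ :=
      exists_succ_first_of_not (p := fun k => prefixSum α k ≤ prefixSum β k) i.2 hlt
        (by rw [prefixSum_self, prefixSum_self, hα.sum_eq, hβ.sum_eq])
    obtain ⟨j, rfl⟩ : ∃ l : Fin n, l.val = j := ⟨⟨j, hjn⟩, rfl⟩
    have hjlt : α j < β j := by
      have := hbetween j hij le_rfl
      rw [prefixSum_succ, prefixSum_succ] at hj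
      omega
    refine ⟨j, hjlt,
      hα.memBoxChain_moveUnit (by omega) (hjlt.trans_le (hβ.le_box j)) fun k hjk hki => by omega,
      hβ.memBoxChain_moveUnit (by omega) (hi.trans_le (hα.le_box i)) fun k hik hkj => ?_⟩
    exact (not_le.1 (hbetween k hik hkj)).trans_le (hα.prefixSum_le (hkj.trans j.2.le))

theorem symmetricExchange_of_memBoxChain {A : Finset (Fin n → ℤ)}
    (hA : ∀ α, α ∈ A ↔ MemBoxChain u c s α) : SymmetricExchange A := by
  intro α hα β hβ i hi
  simp only [hA] at hα hβ ⊢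
  exact hα.exists_exchange hβ hi

end BoxChain

section LehmerCode

variable {n : ℕ}

/-- The Lehmer code of a permutation: the value at `i` is the number of later entries that are
smaller than the entry at `i`. -/
def lehmerCode (σ : Equiv.Perm (Fin n)) (i : Fin n) : ℕ :=
  (Finset.univ.filter fun b => i < b ∧ σ b < σ i).card

/-- The number of inversions of a permutation. -/
def inversionNumber (σ : Equiv.Perm (Fin n)) : ℕ :=
  ∑ i, lehmerCode σ i

theorem lehmerCode_add_val_lt (σ : Equiv.Perm (Fin n)) (i : Fin n) : lehmerCode σ i + i < n := by
  have hsub : (Finset.univ.filter fun b => i < b ∧ σ b < σ i) ⊆ Finset.Ioi i :=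
    fun b hb => Finset.mem_Ioi.2 (Finset.mem_filter.1 hb).2.1
  have hcard := Finset.card_le_card hsub
  rw [Fin.card_Ioi] at hcard
  simp only [lehmerCode]
  omega

theorem inversionNumber_le (σ : Equiv.Perm (Fin n)) : inversionNumber σ ≤ n * n := by
  simpa [inversionNumber] using Finset.sum_le_card_nsmul Finset.univ (lehmerCode σ) n
    fun i _ => by have := lehmerCode_add_val_lt σ i; omega

theorem inversionNumber_one : inversionNumber (1 : Equiv.Perm (Fin n)) = 0 := by
  simp only [inversionNumber, lehmerCode, Finset.sum_eq_zero_iff, Finset.card_eq_zero]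
  exact fun i _ => Finset.filter_eq_empty_iff.2 fun b _ h => h.1.asymm h.2

theorem lehmerCode_of_strictAnti {σ : Equiv.Perm (Fin n)} (hσ : StrictAnti σ) (i : Fin n) :
    lehmerCode σ i = n - 1 - i := by
  have hIoi : (Finset.univ.filter fun b => i < b ∧ σ b < σ i) = Finset.Ioi i := by
    ext b
    simpa using fun hb => hσ hb
  rw [lehmerCode, hIoi, Fin.card_Ioi]

/-- The transposition of the adjacent positions `k` and `k + 1`. -/
abbrev adjSwap (k : Fin n) : Equiv.Perm (Fin (n + 1)) :=
  Equiv.swap k.castSucc k.succ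

theorem adjSwap_lt_adjSwap {k : Fin n} {x y : Fin (n + 1)} (hxy : x < y)
    (h : ¬(x = k.castSucc ∧ y = k.succ)) : adjSwap k x < adjSwap k y := by
  simp only [Equiv.swap_apply_def]
  split_ifs <;>
    simp only [Fin.ext_iff, Fin.lt_def, Fin.val_castSucc, Fin.val_succ] at * <;> omega

theorem adjSwap_lt_adjSwap_iff {k : Fin n} {x y : Fin (n + 1)}
    (h : ¬(x = k.castSucc ∧ y = k.succ)) (h' : ¬(x = k.succ ∧ y = k.castSucc)) :
    adjSwap k x < adjSwap k y ↔ x < y := by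
  refine ⟨fun hlt => ?_, fun hlt => adjSwap_lt_adjSwap hlt h⟩
  have hback := adjSwap_lt_adjSwap (k := k) hlt fun ⟨hx, hy⟩ => h' ⟨?_, ?_⟩
  · simpa [adjSwap] using hback
  · simpa [adjSwap, Equiv.swap_apply_eq_iff] using hx
  · simpa [adjSwap, Equiv.swap_apply_eq_iff] using hy

theorem lehmerCode_mul_adjSwap (σ : Equiv.Perm (Fin (n + 1))) {k : Fin n}
    (hk : σ k.castSucc < σ k.succ) (j : Fin (n + 1)) :
    lehmerCode (σ * adjSwap k) (adjSwap k j) =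
      lehmerCode σ j + if j = k.succ then 1 else 0 := by
  have hreindex : lehmerCode (σ * adjSwap k) (adjSwap k j) =
      (Finset.univ.filter fun b => adjSwap k j < adjSwap k b ∧ σ b < σ j).card := by
    refine Finset.card_equiv (adjSwap k) fun b => ?_
    rw [Finset.mem_filter, Finset.mem_filter]
    simp [adjSwap]
  rw [hreindex, lehmerCode]
  by_cases hj : j = k.succ
  · subst hj
    rw [if_pos rfl, ← Finset.card_insert_of_notMem (a := k.castSucc)]
    · congr 1
      ext b
      rcases eq_or_ne b k.castSucc with rfl | hb
      · simp [adjSwap, hk]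
      · simp only [Finset.mem_filter, Finset.mem_univ, true_and, Finset.mem_insert, hb, false_or]
        rw [adjSwap_lt_adjSwap_iff (fun h => Fin.castSucc_lt_succ.ne' h.1) fun h => hb h.2]
    · simp [Fin.castSucc_lt_succ.not_gt]
  · rw [if_neg hj, add_zero]
    congr 1
    ext b
    simp only [Finset.mem_filter, Finset.mem_univ, true_and, and_congr_left_iff]
    refine fun hb => adjSwap_lt_adjSwap_iff ?_ fun h => hj h.1
    rintro ⟨rfl, rfl⟩
    exact hb.asymm hk

theorem inversionNumber_mul_adjSwap (σ : Equiv.Perm (Fin (n + 1))) {k : Fin n}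
    (hk : σ k.castSucc < σ k.succ) :
    inversionNumber (σ * adjSwap k) = inversionNumber σ + 1 := by
  rw [inversionNumber, ← Equiv.sum_comp (adjSwap k), inversionNumber]
  simp only [lehmerCode_mul_adjSwap σ hk, Finset.sum_add_distrib, Finset.sum_ite_eq',
    Finset.mem_univ, if_true]

end LehmerCode

section Avoids132

variable {n : ℕ}

/-- Avoidance of the pattern 132; the permutations with this property are the dominant ones. -/
def Avoids132 (σ : Equiv.Perm (Fin n)) : Prop :=
  ∀ a b c, a < b → b < c → σ a < σ c → ¬σ c < σ b

theorem IsDominantPerm.avoids132 {σ : Equiv.Perm (Fin n)} (hσ : IsDominantPerm σ) :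
    Avoids132 σ := by
  intro a b c hab hbc hac hcb
  have hmem : (b, σ c) ∈ rotheDiagram σ := ⟨hcb, by simpa using hbc⟩
  have hlower : (a, σ a) ∈ rotheDiagram σ := hσ (⟨hab.le, hac.le⟩ : (a, σ a) ≤ (b, σ c)) hmem
  exact lt_irrefl _ hlower.1

theorem Avoids132.antitone_lehmerCode {σ : Equiv.Perm (Fin n)} (hσ : Avoids132 σ) :
    Antitone (lehmerCode σ) := by
  refine antitone_iff_forall_lt.2 fun i j hij => Finset.card_le_card fun b hb => ?_
  simp only [Finset.mem_filter, Finset.mem_univ, true_and] at hb ⊢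
  have hne : σ i ≠ σ b := fun e => (hij.trans hb.1).ne (σ.injective e)
  exact ⟨hij.trans hb.1, not_le.1 fun hle => hσ i j b hij hb.1 (hle.lt_of_ne hne) hb.2⟩

theorem Avoids132.lehmerCode_eq_of_ascent {σ : Equiv.Perm (Fin (n + 1))} (hσ : Avoids132 σ)
    {k : Fin n} (hk : σ k.castSucc < σ k.succ) :
    lehmerCode σ k.castSucc = lehmerCode σ k.succ := by
  refine le_antisymm (Finset.card_le_card fun b hb => ?_)
    (hσ.antitone_lehmerCode Fin.castSucc_lt_succ.le)
  simp only [Finset.mem_filter, Finset.mem_univ, true_and] at hb ⊢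
  have hne : b ≠ k.succ := by rintro rfl; exact hb.2.asymm hk
  exact ⟨(Fin.castSucc_lt_iff_succ_le.1 hb.1).lt_of_ne hne.symm, hb.2.trans hk⟩

theorem Avoids132.lehmerCode_mul_adjSwap {σ : Equiv.Perm (Fin (n + 1))} (hσ : Avoids132 σ)
    {k : Fin n} (hk : σ k.castSucc < σ k.succ) (i : Fin (n + 1)) :
    lehmerCode (σ * adjSwap k) i = lehmerCode σ i + if i = k.castSucc then 1 else 0 := by
  have hcode := _root_.lehmerCode_mul_adjSwap σ hk (adjSwap k i)
  rw [adjSwap, Equiv.swap_apply_self] at hcode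
  rw [hcode]
  rcases eq_or_ne i k.castSucc with rfl | hi
  · simp [hσ.lehmerCode_eq_of_ascent hk]
  rcases eq_or_ne i k.succ with rfl | hi'
  · simp [hσ.lehmerCode_eq_of_ascent hk, hi, hi.symm]
  · simp [Equiv.swap_apply_of_ne_of_ne hi hi', hi, hi']

theorem lt_of_forall_descent {α : Type*} [Preorder α] {f : Fin (n + 1) → α} (m : Fin (n + 1))
    (hf : ∀ j : Fin n, j.castSucc < m → f j.succ < f j.castSucc) : ∀ a < m, f m < f a := by
  induction m using Fin.induction with
  | zero => exact fun a ha => absurd ha a.not_lt_zero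
  | succ i ih =>
    intro a ha
    have hi := hf i Fin.castSucc_lt_succ
    rcases (Fin.le_castSucc_iff.2 ha).eq_or_lt with rfl | hai
    · exact hi
    · exact hi.trans (ih (fun j hj => hf j (hj.trans Fin.castSucc_lt_succ)) a hai)

theorem Avoids132.mul_adjSwap_of_first_ascent {σ : Equiv.Perm (Fin (n + 1))} (hσ : Avoids132 σ)
    {k : Fin n} (hk : σ k.castSucc < σ k.succ)
    (hfirst : ∀ j < k, σ j.succ < σ j.castSucc) : Avoids132 (σ * adjSwap k) := by
  intro a b c hab hbc hac hcb
  simp only [Equiv.Perm.mul_apply] at hac hcb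
  by_cases hk₁ : a = k.castSucc ∧ b = k.succ
  · obtain ⟨rfl, rfl⟩ := hk₁
    simp only [adjSwap, Equiv.swap_apply_left, Equiv.swap_apply_right] at hac hcb
    exact (hac.trans (hcb.trans hk)).false
  by_cases hk₂ : b = k.castSucc ∧ c = k.succ
  · obtain ⟨rfl, rfl⟩ := hk₂
    rw [adjSwap, Equiv.swap_apply_right,
      Equiv.swap_apply_of_ne_of_ne hab.ne (hab.trans hbc).ne] at hac
    exact hac.asymm (lt_of_forall_descent k.castSucc
      (fun j hj => hfirst j (Fin.castSucc_lt_castSucc_iff.1 hj)) a hab)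
  · exact hσ _ _ _ (adjSwap_lt_adjSwap hab hk₁) (adjSwap_lt_adjSwap hbc hk₂) hac hcb

theorem induction_of_first_ascent {P : Equiv.Perm (Fin (n + 1)) → Prop}
    (longest : ∀ σ : Equiv.Perm (Fin (n + 1)), StrictAnti σ → P σ)
    (step : ∀ (σ : Equiv.Perm (Fin (n + 1))) (k : Fin n), σ k.castSucc < σ k.succ →
      (∀ j < k, σ j.succ < σ j.castSucc) → P (σ * adjSwap k) → P σ)
    (σ : Equiv.Perm (Fin (n + 1))) : P σ := by
  induction hN : (n + 1) * (n + 1) - inversionNumber σ using Nat.strong_induction_on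
    generalizing σ with
  | _ N ih =>
    by_cases hanti : ∀ k : Fin n, σ k.succ < σ k.castSucc
    · exact longest σ (Fin.strictAnti_iff_succ_lt.2 hanti)
    push Not at hanti
    obtain ⟨k, hk, hmin⟩ := WellFounded.has_min wellFounded_lt
      {k : Fin n | σ k.castSucc ≤ σ k.succ} hanti
    have hascent : σ k.castSucc < σ k.succ :=
      lt_of_le_of_ne hk (σ.injective.ne Fin.castSucc_lt_succ.ne)
    refine step σ k hascent (fun j hj => not_le.1 fun h => hmin j h hj) (ih _ ?_ _ rfl)
    have hinv := inversionNumber_mul_adjSwap σ hascent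
    have hbound := inversionNumber_le (σ * adjSwap k)
    omega

end Avoids132

section InsertZero

variable {n : ℕ}

/-- The permutation of `{0, …, n}` obtained from `τ`, relabelled as a permutation of `{1, …, n}`, by
inserting the entry `0` at position `k`. -/
def insertZero (k : Fin (n + 1)) (τ : Equiv.Perm (Fin n)) : Equiv.Perm (Fin (n + 1)) :=
  (finSuccEquiv' k).trans (τ.optionCongr.trans (finSuccEquiv n).symm)

@[simp]
theorem insertZero_self (k : Fin (n + 1)) (τ : Equiv.Perm (Fin n)) : insertZero k τ k = 0 := by
  simp [insertZero]

@[simp]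
theorem insertZero_succAbove (k : Fin (n + 1)) (τ : Equiv.Perm (Fin n)) (i : Fin n) :
    insertZero k τ (k.succAbove i) = (τ i).succ := by
  simp [insertZero]

@[simp]
theorem insertZero_last_castSucc (τ : Equiv.Perm (Fin n)) (i : Fin n) :
    insertZero (Fin.last n) τ i.castSucc = (τ i).succ := by
  rw [← Fin.succAbove_last_apply, insertZero_succAbove]

@[simp]
theorem insertZero_zero_succ (τ : Equiv.Perm (Fin n)) (i : Fin n) :
    insertZero 0 τ i.succ = (τ i).succ := by
  rw [← Fin.succAbove_zero_apply, insertZero_succAbove]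

theorem insertZero_castSucc_lt_succ (τ : Equiv.Perm (Fin n)) (k : Fin n) :
    insertZero k.castSucc τ k.castSucc < insertZero k.castSucc τ k.succ := by
  rw [← Fin.succAbove_castSucc_self, insertZero_self, insertZero_succAbove]
  exact Fin.succ_pos _

theorem insertZero_castSucc_mul_adjSwap (τ : Equiv.Perm (Fin n)) (k : Fin n) :
    insertZero k.castSucc τ * adjSwap k = insertZero k.succ τ := by
  refine Equiv.ext fun x => ?_
  rw [Equiv.Perm.mul_apply]
  rcases eq_or_ne x k.succ with rfl | hx
  · simp [adjSwap]
  obtain ⟨i, rfl⟩ := Fin.exists_succAbove_eq hx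
  rw [insertZero_succAbove]
  rcases eq_or_ne i k with rfl | hi
  · rw [Fin.succAbove_succ_self, adjSwap, Equiv.swap_apply_left, ← Fin.succAbove_castSucc_self,
      insertZero_succAbove]
  · have habove : k.succ.succAbove i = k.castSucc.succAbove i := by
      rcases hi.lt_or_gt with h | h
      · rw [Fin.succAbove_of_castSucc_lt _ _ (by simpa using h.le),
          Fin.succAbove_of_castSucc_lt _ _ (by simpa using h)]
      · rw [Fin.succAbove_of_le_castSucc _ _ (by simpa using h),
          Fin.succAbove_of_le_castSucc _ _ (by simpa using h.le)]
    rw [adjSwap, Equiv.swap_apply_of_ne_of_ne (habove ▸ Fin.succAbove_ne _ _)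
      (Fin.succAbove_ne _ _), habove, insertZero_succAbove]

theorem Avoids132.insertZero_last {τ : Equiv.Perm (Fin n)} (hτ : Avoids132 τ) :
    Avoids132 (insertZero (Fin.last n) τ) := by
  intro a b c hab hbc hac hcb
  induction c using Fin.lastCases with
  | last => simp at hac
  | cast c =>
    obtain ⟨b, rfl⟩ := Fin.exists_castSucc_eq.2 (hbc.trans_le (Fin.le_last _)).ne
    obtain ⟨a, rfl⟩ := Fin.exists_castSucc_eq.2
      ((hab.trans hbc).trans_le (Fin.le_last _)).ne
    simp only [insertZero_last_castSucc, Fin.succ_lt_succ_iff] at hac hcb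
    exact hτ a b c hab hbc hac hcb

theorem lehmerCode_eq_sum (σ : Equiv.Perm (Fin n)) (i : Fin n) :
    lehmerCode σ i = ∑ b, if i < b ∧ σ b < σ i then 1 else 0 :=
  Finset.card_filter _ _

theorem lehmerCode_insertZero_last_castSucc (τ : Equiv.Perm (Fin n)) (i : Fin n) :
    lehmerCode (insertZero (Fin.last n) τ) i.castSucc = lehmerCode τ i + 1 := by
  simp [lehmerCode_eq_sum, Fin.sum_univ_castSucc, -Finset.sum_boole]

theorem inversionNumber_insertZero_zero (τ : Equiv.Perm (Fin n)) :
    inversionNumber (insertZero 0 τ) = inversionNumber τ := by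
  simp [inversionNumber, lehmerCode_eq_sum, Fin.sum_univ_succ, -Finset.sum_boole]

end InsertZero

section Tiles

variable {n : ℕ}

/-- The antidiagonal of a tile, numbered from the north-west corner. -/
def Tile.diagonal (c : Tile n) : Fin n :=
  ⟨c.1.1 + c.1.2, c.2⟩

theorem mem_tileList (c : Tile n) : c ∈ tileList n := by
  obtain ⟨⟨i, j⟩, h⟩ := c
  simp only [tileList, List.mem_flatMap, List.mem_finRange, true_and, List.mem_filterMap,
    List.mem_reverse]
  exact ⟨i, j, dif_pos h⟩

theorem nodup_tileList (n : ℕ) : (tileList n).Nodup := by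
  rw [tileList, List.nodup_flatMap]
  refine ⟨fun i _ => ?_, (List.nodup_finRange n).imp fun {i i'} hne c hc hc' => ?_⟩
  · refine (List.nodup_reverse.2 (List.nodup_finRange n)).filterMap fun j j' c hc hc' => ?_
    simp only [Option.mem_def, Option.dite_none_right_eq_some, Option.some.injEq] at hc hc'
    grind
  · simp only [List.mem_filterMap, Option.dite_none_right_eq_some, Option.some.injEq] at hc hc'
    grind

theorem length_crossList (D : Finset (Tile n)) : (crossList D).length = D.card := by
  have hD : (crossList D).toFinset = D := by
    ext c
    simp [crossList, mem_tileList]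
  have hnodup : (crossList D).Nodup := (nodup_tileList n).filter _
  rw [← List.toFinset_card_of_nodup hnodup, hD]

theorem inversionNumber_passCross (σ : Equiv.Perm (Fin (n + 1))) (c : Tile n) :
    inversionNumber (passCross σ c) =
      inversionNumber σ + if σ (topEdge c) < σ (rightEdge c) then 1 else 0 := by
  rw [passCross]
  split_ifs with h
  exacts [inversionNumber_mul_adjSwap σ (k := Tile.diagonal c) h, rfl]

theorem inversionNumber_foldl_passCross_le (l : List (Tile n)) (σ : Equiv.Perm (Fin (n + 1))) :
    inversionNumber (l.foldl passCross σ) ≤ inversionNumber σ + l.length := by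
  induction l generalizing σ with
  | nil => simp
  | cons c l ih =>
    have hl := ih (passCross σ c)
    rw [inversionNumber_passCross] at hl
    simp only [List.foldl_cons, List.length_cons]
    split_ifs at hl <;> omega

theorem noSecondCrossing_iff (l : List (Tile n)) (σ : Equiv.Perm (Fin (n + 1))) :
    NoSecondCrossing l σ ↔
      inversionNumber (l.foldl passCross σ) = inversionNumber σ + l.length := by
  induction l generalizing σ with
  | nil => simp [NoSecondCrossing]
  | cons c l ih =>
    have hle := inversionNumber_foldl_passCross_le l (passCross σ c)
    simp only [NoSecondCrossing, ih, List.foldl_cons, List.length_cons]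
    rw [inversionNumber_passCross] at hle ⊢
    split_ifs at hle ⊢ with h <;> simp only [h, true_and, false_and, false_iff] <;> omega

theorem inversionNumber_strandPerm_le (D : Finset (Tile n)) :
    inversionNumber (strandPerm D) ≤ D.card := by
  simpa only [inversionNumber_one, zero_add, length_crossList, strandPerm] using
    inversionNumber_foldl_passCross_le (crossList D) 1

theorem isReducedTiling_iff (D : Finset (Tile n)) :
    IsReducedTiling D ↔ D.card = inversionNumber (strandPerm D) := by
  rw [IsReducedTiling, noSecondCrossing_iff, inversionNumber_one, zero_add, length_crossList,
    eq_comm, strandPerm]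

/-- The tiles, sorted by rows. -/
def tileEquivSigma (n : ℕ) : Tile n ≃ Σ i : Fin n, Fin (n - i) where
  toFun c := ⟨c.1.1, ⟨c.1.2, Nat.lt_sub_iff_add_lt'.2 c.2⟩⟩
  invFun s := ⟨(s.1, ⟨s.2, s.2.2.trans_le (Nat.sub_le _ _)⟩), Nat.lt_sub_iff_add_lt'.1 s.2.2⟩

theorem card_tile (n : ℕ) : Fintype.card (Tile n) = ∑ i : Fin n, (n - i) := by
  simp [Fintype.card_congr (tileEquivSigma n)]

theorem eq_univ_of_strictAnti_strandPerm {D : Finset (Tile n)} (hD : StrictAnti (strandPerm D)) :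
    D = Finset.univ := by
  rw [← Finset.card_eq_iff_eq_univ]
  refine (Finset.card_le_univ D).antisymm ?_
  rw [card_tile]
  simpa [inversionNumber, Fin.sum_univ_castSucc, lehmerCode_of_strictAnti hD] using
    inversionNumber_strandPerm_le D

end Tiles

section FominKirillov

variable {R E : Type*} [CommRing R] [Ring E] [Algebra R E]

/-- The factor `1 + x u_k` of Fomin and Kirillov. -/
def hFactor (U : ℕ → E) (k : ℕ) (x : R) : E := 1 + x • U k

/-- The multiple `(1 + y) h_k((x - y) / (1 + y))` of a factor by which `h_k(y)` has to be multiplied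
to become a multiple of `h_k(x)`. -/
def exchangeFactor (U : ℕ → E) (k : ℕ) (x y : R) : E := (1 + y) • (1 : E) + (x - y) • U k

/-- The product `h_i(x) h_{i+1}(x) ⋯ h_{i+d-1}(x)`. -/
def rowFactor (U : ℕ → E) : ℕ → ℕ → R → E
  | 0, _, _ => 1
  | d + 1, i, x => hFactor U i x * rowFactor U d (i + 1) x

/-- The product of the factors of the rows `m - 1, …, 0`, where row `i` is
`h_i(x_i) h_{i+1}(x_i) ⋯ h_{n-1}(x_i)`. -/
def rowsFactor (U : ℕ → E) (n : ℕ) (x : ℕ → R) : ℕ → E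
  | 0 => 1
  | m + 1 => rowFactor U (n - m) m (x m) * rowsFactor U n x m

/-- The relations of the 0-Hecke monoid. -/
structure ZeroHeckeRelations (U : ℕ → E) : Prop where
  idem : ∀ k, U k * U k = U k
  braid : ∀ k, U k * U (k + 1) * U k = U (k + 1) * U k * U (k + 1)
  comm : ∀ k l, k + 2 ≤ l → Commute (U k) (U l)

variable {U : ℕ → E}

theorem commute_hFactor_hFactor {k l : ℕ} (h : Commute (U k) (U l)) (x y : R) :
    Commute (hFactor U k x) (hFactor U l y) :=
  (Commute.one_left _).add_left (((Commute.one_right _).add_right (h.smul_right y)).smul_left x)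

theorem commute_hFactor_rowFactor (hU : ZeroHeckeRelations U) {k l : ℕ} (hkl : k + 2 ≤ l)
    (x y : R) (d : ℕ) : Commute (hFactor U k x) (rowFactor U d l y) := by
  induction d generalizing l with
  | zero => exact Commute.one_right _
  | succ d ih =>
    exact (commute_hFactor_hFactor (hU.comm k l hkl) x y).mul_right (ih (hkl.trans l.le_succ))

theorem rowFactor_eq_prod (U : ℕ → E) (x : R) (d i : ℕ) :
    rowFactor U d i x = ((List.range d).map fun j => hFactor U (i + j) x).prod := by
  induction d generalizing i with
  | zero => rfl
  | succ d ih =>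
    simp only [rowFactor, ih, List.range_succ_eq_map, List.map_cons, List.prod_cons, List.map_map,
      Function.comp_def, add_zero, Nat.succ_eq_add_one, Nat.add_assoc, Nat.add_comm 1]

theorem yangBaxter (hU : ZeroHeckeRelations U) (i : ℕ) (x y : R) :
    hFactor U (i + 1) y * hFactor U i x * exchangeFactor U (i + 1) x y =
      exchangeFactor U i x y * hFactor U (i + 1) x * hFactor U i y := by
  have idem := hU.idem i
  have idem' := hU.idem (i + 1)
  have braid := hU.braid i
  unfold hFactor exchangeFactor
  generalize U i = u at *
  generalize U (i + 1) = v at *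
  simp only [mul_add, add_mul, mul_one, one_mul, smul_mul_assoc, mul_smul_comm, smul_add,
    smul_smul, idem, idem', braid]
  module

theorem hFactor_mul_exchangeFactor (hU : ZeroHeckeRelations U) (i : ℕ) (x y : R) :
    hFactor U i y * exchangeFactor U i x y = (1 + y) • hFactor U i x := by
  simp only [hFactor, exchangeFactor, mul_add, add_mul, mul_one, one_mul, smul_mul_assoc,
    mul_smul_comm, smul_add, smul_smul, hU.idem i]
  module

theorem smul_eq_exchangeFactor_mul (hU : ZeroHeckeRelations U) {i : ℕ} {x y : R} {p q : E}
    (hpq : hFactor U i y * p = hFactor U i x * q) : (1 + y) • p = exchangeFactor U i x y * q := by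
  -- `(1 + y) - y U_i` is the inverse of `h_i(y)` up to the scalar `1 + y`.
  have quasiInverse (z : R) :
      ((1 + y) • (1 : E) - y • U i) * hFactor U i z = exchangeFactor U i z y := by
    simp only [hFactor, exchangeFactor, mul_add, sub_mul, mul_one, one_mul, smul_mul_assoc,
      mul_smul_comm, smul_smul, smul_sub, hU.idem i]
    module
  calc (1 + y) • p = exchangeFactor U i y y * p := by simp [exchangeFactor]
    _ = ((1 + y) • (1 : E) - y • U i) * (hFactor U i y * p) := by
      rw [← quasiInverse, mul_assoc]
    _ = exchangeFactor U i x y * q := by rw [hpq, ← quasiInverse, mul_assoc]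

theorem smul_hFactor_mul_eq_of_hFactor_mul_eq (hU : ZeroHeckeRelations U) {i : ℕ} {x y : R}
    {p q : E} (hpq : hFactor U (i + 1) y * p = hFactor U (i + 1) x * q) :
    (1 + y) • (hFactor U i y * hFactor U (i + 1) y * hFactor U i x * p) =
      (1 + y) • (hFactor U i x * hFactor U (i + 1) x * hFactor U i y * q) := by
  calc (1 + y) • (hFactor U i y * hFactor U (i + 1) y * hFactor U i x * p)
      = hFactor U i y * (hFactor U (i + 1) y * hFactor U i x * exchangeFactor U (i + 1) x y) *
          q := by
        rw [← mul_smul_comm, smul_eq_exchangeFactor_mul hU hpq]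
        simp only [mul_assoc]
    _ = hFactor U i y * exchangeFactor U i x y * (hFactor U (i + 1) x * hFactor U i y) * q := by
        rw [yangBaxter hU]
        simp only [mul_assoc]
    _ = (1 + y) • (hFactor U i x * hFactor U (i + 1) x * hFactor U i y * q) := by
        rw [hFactor_mul_exchangeFactor hU]
        simp only [mul_assoc, smul_mul_assoc]

theorem commute_rowFactor_rowFactor (hU : ZeroHeckeRelations U) (x : R) {y : R}
    (hy : IsSMulRegular E (1 + y)) (d i : ℕ) :
    Commute (rowFactor U d i y) (rowFactor U d i x) := by
  induction d generalizing i with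
  | zero => exact Commute.one_left _
  | succ d ih =>
    rcases d with _ | d
    · simpa [rowFactor] using commute_hFactor_hFactor (Commute.refl (U i)) y x
    · have ih := (ih (i + 1)).eq
      have regroup (x y : R) : rowFactor U (d + 2) i y * rowFactor U (d + 2) i x =
          hFactor U i y * hFactor U (i + 1) y * hFactor U i x *
            (rowFactor U d (i + 2) y * rowFactor U (d + 1) (i + 1) x) := by
        have hcomm := (commute_hFactor_rowFactor hU (le_refl (i + 2)) x y d).eq
        simp only [rowFactor, mul_assoc]
        rw [← mul_assoc (rowFactor U d (i + 1 + 1) y), ← hcomm, mul_assoc]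
      refine hy ?_
      change (1 + y) • (_ * _) = (1 + y) • (_ * _)
      rw [regroup, regroup]
      refine smul_hFactor_mul_eq_of_hFactor_mul_eq hU ?_
      rw [← mul_assoc, ← mul_assoc]
      exact ih

theorem rowsFactor_congr {n m : ℕ} {x y : ℕ → R} (h : ∀ i < m, x i = y i) :
    rowsFactor U n x m = rowsFactor U n y m := by
  induction m with
  | zero => rfl
  | succ m ih => rw [rowsFactor, rowsFactor, h m m.lt_succ_self, ih fun i hi => h i (by omega)]

theorem hFactor_mul_rowsFactor (hU : ZeroHeckeRelations U) {x : ℕ → R} {i n m : ℕ}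
    (hx : IsSMulRegular E (1 + x (i + 1))) (hi : i < n) (hm : i + 2 ≤ m) :
    hFactor U i (x (i + 1)) * rowsFactor U n x m =
      hFactor U i (x i) * rowsFactor U n (x ∘ Equiv.swap i (i + 1)) m := by
  have swap_of_ne (j : ℕ) (hj : j ≠ i) (hj' : j ≠ i + 1) :
      (x ∘ Equiv.swap i (i + 1)) j = x j := by
    rw [Function.comp_apply, Equiv.swap_apply_of_ne_of_ne hj hj']
  induction m, hm using Nat.le_induction with
  | base =>
    have hfirst : rowsFactor U n (x ∘ Equiv.swap i (i + 1)) i = rowsFactor U n x i :=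
      rowsFactor_congr fun j hj => swap_of_ne j hj.ne (by omega)
    have hrow (y : R) : hFactor U i y * rowFactor U (n - (i + 1)) (i + 1) y =
        rowFactor U (n - i) i y := by
      rw [show n - i = n - (i + 1) + 1 by omega, rowFactor]
    simp only [rowsFactor, Function.comp_apply, Equiv.swap_apply_left, Equiv.swap_apply_right,
      hfirst]
    rw [← mul_assoc, ← mul_assoc, ← mul_assoc, ← mul_assoc, hrow, hrow,
      (commute_rowFactor_rowFactor hU (x i) hx _ _).eq]
  | succ m hm ih =>
    have hcomm (y : R) := commute_hFactor_rowFactor hU hm y (x m) (n - m)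
    rw [rowsFactor, rowsFactor, swap_of_ne m (by omega) (by omega), ← mul_assoc, (hcomm _).eq,
      mul_assoc, ih, ← mul_assoc, ← (hcomm _).eq, mul_assoc]

end FominKirillov

section SortStep

variable {α : Type*} [LinearOrder α]

/-- One step of the Demazure product: the entries at `a` and `b` are interchanged if they are in
increasing order. -/
def sortStep (a b : α) (σ : Equiv.Perm α) : Equiv.Perm α :=
  if σ a < σ b then σ * Equiv.swap a b else σ

theorem sortStep_idem (a b : α) (σ : Equiv.Perm α) :
    sortStep a b (sortStep a b σ) = sortStep a b σ := by
  by_cases h : σ a < σ b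
  · simp [sortStep, h, h.not_gt]
  · simp [sortStep, h]

theorem sortStep_braid {a b c : α} (hab : a ≠ b) (hbc : b ≠ c) (hac : a ≠ c)
    (σ : Equiv.Perm α) :
    sortStep a b (sortStep b c (sortStep a b σ)) =
      sortStep b c (sortStep a b (sortStep b c σ)) := by
  have hba : σ b < σ a ↔ ¬σ a < σ b :=
    ⟨lt_asymm, fun h => (not_lt.1 h).lt_of_ne (σ.injective.ne hab.symm)⟩
  have hcb : σ c < σ b ↔ ¬σ b < σ c :=
    ⟨lt_asymm, fun h => (not_lt.1 h).lt_of_ne (σ.injective.ne hbc.symm)⟩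
  have swap_c : Equiv.swap a b c = c := Equiv.swap_apply_of_ne_of_ne hac.symm hbc.symm
  have swap_a : Equiv.swap b c a = a := Equiv.swap_apply_of_ne_of_ne hab hac
  have swap_braid : Equiv.swap a b * (Equiv.swap b c * Equiv.swap a b) =
      Equiv.swap b c * (Equiv.swap a b * Equiv.swap b c) := by
    have hswap := Equiv.swap_mul_swap_mul_swap hbc.symm hac.symm
    rw [Equiv.swap_comm c b, Equiv.swap_comm b a, Equiv.swap_comm a c] at hswap
    rw [← mul_assoc, ← mul_assoc, hswap, Equiv.swap_mul_swap_mul_swap hab hac]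
  by_cases h₁ : σ a < σ b <;> by_cases h₂ : σ b < σ c <;> by_cases h₃ : σ a < σ c <;>
    first
    | exfalso; order
    | simp [sortStep, hba, hcb, h₁, h₂, h₃, swap_a, swap_c, swap_braid, mul_assoc]

theorem sortStep_comm {a b c d : α} (h : [a, b, c, d].Nodup) (σ : Equiv.Perm α) :
    sortStep a b (sortStep c d σ) = sortStep c d (sortStep a b σ) := by
  have hcomm := (Equiv.Perm.disjoint_swap_swap h).commute.eq
  simp only [List.nodup_cons, List.mem_cons, List.not_mem_nil, not_or, or_false] at h
  obtain ⟨⟨-, hac, had⟩, ⟨hbc, hbd⟩, -⟩ := h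
  have swap_a := Equiv.swap_apply_of_ne_of_ne hac had
  have swap_b := Equiv.swap_apply_of_ne_of_ne hbc hbd
  have swap_c := Equiv.swap_apply_of_ne_of_ne (Ne.symm hac) (Ne.symm hbc)
  have swap_d := Equiv.swap_apply_of_ne_of_ne (Ne.symm had) (Ne.symm hbd)
  by_cases h₁ : σ a < σ b <;> by_cases h₂ : σ c < σ d <;>
    simp [sortStep, h₁, h₂, swap_a, swap_b, swap_c, swap_d, mul_assoc, hcomm]

end SortStep

section Demazure

variable {n : ℕ} (R : Type*) [CommRing R]

/-- The generators of the 0-Hecke algebra acting on the free module on the permutations. There are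
only `n` of them; the later members of the sequence are `0`. -/
noncomputable def demazureOp (n k : ℕ) : Module.End R (Equiv.Perm (Fin (n + 1)) →₀ R) :=
  if h : k < n then
    Finsupp.lmapDomain R R (sortStep (Fin.castSucc ⟨k, h⟩) (Fin.succ ⟨k, h⟩))
  else 0

theorem demazureOp_single (k : Fin n) (σ : Equiv.Perm (Fin (n + 1))) (a : R) :
    demazureOp R n k (Finsupp.single σ a) =
      Finsupp.single (sortStep k.castSucc k.succ σ) a := by
  rw [demazureOp, dif_pos k.2, Finsupp.lmapDomain_apply, Finsupp.mapDomain_single]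

theorem zeroHeckeRelations_demazureOp : ZeroHeckeRelations (demazureOp R n) where
  idem k := by
    by_cases h : k < n
    · lift k to Fin n using h
      ext σ : 2
      simp [demazureOp_single, sortStep_idem]
    · simp [demazureOp, h]
  braid k := by
    rcases n with _ | n
    · simp [demazureOp]
    by_cases h : k < n
    · lift k to Fin n using h
      have hbraid := sortStep_braid (a := k.castSucc.castSucc) (b := k.succ.castSucc)
        (c := k.succ.succ) (by simp [Fin.ext_iff]) (by simp [Fin.ext_iff])
        (by simp [Fin.ext_iff, Nat.add_assoc])
      have single_castSucc (σ) := demazureOp_single R k.castSucc σ 1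
      have single_succ (σ) := demazureOp_single R k.succ σ 1
      rw [Fin.val_castSucc] at single_castSucc
      rw [Fin.val_succ] at single_succ
      ext σ : 2
      simp [single_castSucc, single_succ, -Fin.castSucc_succ, Fin.succ_castSucc, hbraid]
    · simp [demazureOp, h]
  comm k l hkl := by
    by_cases h : l < n
    · lift l to Fin n using h
      lift k to Fin n using by omega
      have hcomm := sortStep_comm (a := k.castSucc) (b := k.succ) (c := l.castSucc) (d := l.succ)
        (by simp [Fin.ext_iff]; omega)
      rw [commute_iff_eq]
      ext σ : 2
      simp [demazureOp_single, hcomm]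
    · simp [demazureOp, h]

theorem demazureOp_apply_of_lt (k : Fin n) (F : Equiv.Perm (Fin (n + 1)) →₀ R)
    {σ : Equiv.Perm (Fin (n + 1))} (hk : σ k.castSucc < σ k.succ) :
    demazureOp R n k F σ = 0 := by
  induction F using Finsupp.induction_linear with
  | zero => simp
  | add F G hF hG => simp [hF, hG]
  | single τ a =>
    rw [demazureOp_single, Finsupp.single_apply, if_neg]
    rintro rfl
    rw [sortStep] at hk
    split_ifs at hk with hτ
    · simp only [Equiv.Perm.mul_apply, Equiv.swap_apply_left, Equiv.swap_apply_right] at hk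
      exact hk.asymm hτ
    · exact hτ hk

theorem demazureOp_apply_mul_adjSwap (k : Fin n) (F : Equiv.Perm (Fin (n + 1)) →₀ R)
    {σ : Equiv.Perm (Fin (n + 1))} (hk : σ k.castSucc < σ k.succ) :
    demazureOp R n k F (σ * adjSwap k) = F (σ * adjSwap k) + F σ := by
  induction F using Finsupp.induction_linear with
  | zero => simp
  | add F G hF hG => simp only [map_add, Finsupp.add_apply, hF, hG]; ring
  | single τ a =>
    have hne : σ * adjSwap k ≠ σ := by
      simpa [mul_eq_left] using Fin.castSucc_lt_succ.ne
    rw [demazureOp_single]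
    simp only [sortStep, Finsupp.single_apply]
    rcases eq_or_ne τ σ with rfl | hτ
    · simp [hk, hne.symm]
    rcases eq_or_ne τ (σ * adjSwap k) with rfl | hτ'
    · simp [hk.not_gt, hne]
    · split_ifs <;> simp_all

end Demazure

section TilingSum

variable {n : ℕ} {R : Type*} [CommRing R]

/-- The generating function of all tilings by their permutation. -/
noncomputable def tilingSum (n : ℕ) (x : ℕ → R) : Equiv.Perm (Fin (n + 1)) →₀ R :=
  ∑ D : Finset (Tile n), Finsupp.single (strandPerm D) (∏ c ∈ D, x c.1.1)

theorem tilingSum_apply (x : ℕ → R) (σ : Equiv.Perm (Fin (n + 1))) :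
    tilingSum n x σ = ∑ D ∈ pipeDreams σ, ∏ c ∈ D, x c.1.1 := by
  rw [tilingSum, Finsupp.finsetSum_apply, pipeDreams, Finset.sum_filter]
  simp only [Finsupp.single_apply]

/-- The product of the factors of a list of tiles; the first tile acts first. -/
noncomputable def tilesFactor (x : ℕ → R) (l : List (Tile n)) :
    Module.End R (Equiv.Perm (Fin (n + 1)) →₀ R) :=
  (l.reverse.map fun c => hFactor (demazureOp R n) (Tile.diagonal c) (x c.1.1)).prod

theorem tilesFactor_cons_single (x : ℕ → R) (c : Tile n) (l : List (Tile n))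
    (σ : Equiv.Perm (Fin (n + 1))) :
    tilesFactor x (c :: l) (Finsupp.single σ 1) = tilesFactor x l (Finsupp.single σ 1) +
      x c.1.1 • tilesFactor x l (Finsupp.single (passCross σ c) 1) := by
  have hpass : demazureOp R n (Tile.diagonal c) (Finsupp.single σ 1) =
      Finsupp.single (passCross σ c) 1 := demazureOp_single R (Tile.diagonal c) σ 1
  rw [tilesFactor, List.reverse_cons, List.map_append, List.prod_append, List.map_singleton,
    List.prod_singleton, Module.End.mul_apply, hFactor, LinearMap.add_apply, LinearMap.smul_apply,
    hpass, Module.End.one_apply, map_add, map_smul, tilesFactor]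

theorem tilesFactor_single (x : ℕ → R) {l : List (Tile n)} (hl : l.Nodup)
    (σ : Equiv.Perm (Fin (n + 1))) :
    tilesFactor x l (Finsupp.single σ 1) = ∑ D ∈ l.toFinset.powerset,
      Finsupp.single ((l.filter fun c => c ∈ D).foldl passCross σ) (∏ c ∈ D, x c.1.1) := by
  induction l generalizing σ with
  | nil => simp [tilesFactor]
  | cons c l ih =>
    obtain ⟨hc, hl⟩ := List.nodup_cons.1 hl
    have hcD (D) (hD : D ∈ l.toFinset.powerset) : c ∉ D := fun h =>
      hc (List.mem_toFinset.1 (Finset.mem_powerset.1 hD h))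
    rw [List.toFinset_cons, Finset.sum_powerset_insert (List.mem_toFinset.not.2 hc),
      tilesFactor_cons_single, ih hl, ih hl, Finset.smul_sum]
    congr 1 <;> refine Finset.sum_congr rfl fun D hD => ?_
    · rw [List.filter_cons_of_neg (by simpa using hcD D hD)]
    · have hfilter : (l.filter fun d => d ∈ insert c D) = l.filter fun d => d ∈ D :=
        List.filter_congr fun d hd => by simp [ne_of_mem_of_not_mem hd hc]
      rw [Finset.prod_insert (hcD D hD), List.filter_cons_of_pos (by simp), List.foldl_cons,
        hfilter, Finsupp.smul_single, smul_eq_mul]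

theorem filterMap_range_ite_lt {α : Type*} (f : ℕ → α) {d m : ℕ} (hdm : d ≤ m) :
    ((List.range m).filterMap fun j => if j < d then some (f j) else none) =
      (List.range d).map f := by
  induction m, hdm using Nat.le_induction with
  | base =>
    rw [← List.filterMap_eq_map]
    exact List.filterMap_congr fun j hj => if_pos (List.mem_range.1 hj)
  | succ m hdm ih => simp [List.range_succ, ih, hdm.not_gt]

theorem tilesFactor_flatMap {ι : Type*} (x : ℕ → R) (l : List ι) (f : ι → List (Tile n)) :
    tilesFactor x (l.flatMap f) = (l.reverse.map fun i => tilesFactor x (f i)).prod := by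
  induction l with
  | nil => rfl
  | cons i l ih =>
    rw [List.flatMap_cons, tilesFactor, List.reverse_append, List.map_append, List.prod_append,
      ← tilesFactor, ih, List.reverse_cons, List.map_append, List.prod_append, List.map_singleton,
      List.prod_singleton, tilesFactor]

theorem rowsFactor_eq_prod {E : Type*} [Ring E] [Algebra R E] (U : ℕ → E) (n : ℕ) (x : ℕ → R)
    (m : ℕ) : rowsFactor U n x m =
      ((List.range m).reverse.map fun i => rowFactor U (n - i) i (x i)).prod := by
  induction m with
  | zero => rfl
  | succ m ih => simp [rowsFactor, ih, List.range_succ]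

theorem tilesFactor_row (x : ℕ → R) (i : Fin n) :
    tilesFactor x ((List.finRange n).reverse.filterMap fun (j : Fin n) =>
      if h : (i : ℕ) + (j : ℕ) < n then some ⟨(i, j), h⟩ else none) =
      rowFactor (demazureOp R n) (n - i) i (x i) := by
  rw [rowFactor_eq_prod, ← filterMap_range_ite_lt _ (Nat.sub_le n i),
    ← List.map_coe_finRange_eq_range, List.filterMap_map, tilesFactor, List.filterMap_reverse,
    List.reverse_reverse, List.map_filterMap]
  congr 2 with j : 1
  simp only [Function.comp_apply, Nat.lt_sub_iff_add_lt']
  split_ifs <;> rfl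

theorem tilesFactor_tileList (x : ℕ → R) :
    tilesFactor x (tileList n) = rowsFactor (demazureOp R n) n x n := by
  rw [tileList, tilesFactor_flatMap, rowsFactor_eq_prod, ← List.map_coe_finRange_eq_range,
    ← List.map_reverse, List.map_map]
  simp only [tilesFactor_row, Function.comp_def]

theorem rowsFactor_demazureOp_single_one (x : ℕ → R) :
    rowsFactor (demazureOp R n) n x (n + 1) (Finsupp.single 1 1) = tilingSum n x := by
  have htoFinset : (tileList n).toFinset = Finset.univ := by
    ext c
    simp [mem_tileList]
  rw [rowsFactor, Nat.sub_self, rowFactor, one_mul, ← tilesFactor_tileList,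
    tilesFactor_single x (nodup_tileList n), htoFinset, Finset.powerset_univ]
  rfl

theorem hFactor_mul_tilingSum [IsDomain R] {x : ℕ → R} {k : Fin n} (hx : 1 + x (k + 1) ≠ 0) :
    tilingSum n x + x (k + 1) • demazureOp R n k (tilingSum n x) =
      tilingSum n (x ∘ Equiv.swap (k : ℕ) (k + 1)) +
        x k • demazureOp R n k (tilingSum n (x ∘ Equiv.swap (k : ℕ) (k + 1))) := by
  have hreg : IsSMulRegular (Module.End R (Equiv.Perm (Fin (n + 1)) →₀ R)) (1 + x (k + 1)) :=
    IsSMulRegular.of_ne_zero hx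
  simpa [hFactor, rowsFactor_demazureOp_single_one] using
    LinearMap.congr_fun (hFactor_mul_rowsFactor (zeroHeckeRelations_demazureOp R) hreg k.2
      (Nat.succ_le_succ k.2)) (Finsupp.single 1 1)

theorem sub_mul_tilingSum [IsDomain R] {x : ℕ → R} {k : Fin n} (hx : 1 + x (k + 1) ≠ 0)
    {σ : Equiv.Perm (Fin (n + 1))} (hk : σ k.castSucc < σ k.succ) :
    (x k - x (k + 1)) * tilingSum n x σ =
      (1 + x (k + 1)) * tilingSum n x (σ * adjSwap k) -
        (1 + x k) * tilingSum n (x ∘ Equiv.swap (k : ℕ) (k + 1)) (σ * adjSwap k) := by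
  have heq := hFactor_mul_tilingSum hx
  have h₁ := DFunLike.congr_fun heq σ
  have h₂ := DFunLike.congr_fun heq (σ * adjSwap k)
  simp only [Finsupp.add_apply, Finsupp.smul_apply, smul_eq_mul,
    demazureOp_apply_of_lt R k _ hk, demazureOp_apply_mul_adjSwap R k _ hk] at h₁ h₂
  linear_combination x k * h₁ - h₂

end TilingSum

open MvPolynomial in
/-- The Grothendieck polynomial with its variables `t_i` indexed by all natural numbers. -/
noncomputable def grothendieckNat {n : ℕ} (σ : Equiv.Perm (Fin (n + 1))) : MvPolynomial ℕ ℤ :=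
  rename Fin.val (grothendieckPoly σ)

section DividedDifference

open MvPolynomial

variable {n : ℕ}

theorem grothendieckNat_eq_sum (σ : Equiv.Perm (Fin (n + 1))) :
    grothendieckNat σ = ∑ D ∈ pipeDreams σ, ∏ c ∈ D, X (c.1.1 : ℕ) := by
  simp only [grothendieckNat, grothendieckPoly, pipeWeight, map_sum, map_prod, rename_X]

theorem tilingSum_X_comp (s : ℕ → ℕ) (σ : Equiv.Perm (Fin (n + 1))) :
    tilingSum n (X ∘ s) σ = rename s (grothendieckNat σ) := by
  simp only [tilingSum_apply, grothendieckNat_eq_sum, map_sum, map_prod, rename_X,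
    Function.comp_apply]

theorem X_sub_X_succ_ne_zero (k : ℕ) : (X k - X (k + 1) : MvPolynomial ℕ ℤ) ≠ 0 :=
  sub_ne_zero.2 (X_injective.ne k.lt_succ_self.ne)

theorem X_sub_X_succ_mul_grothendieckNat {σ : Equiv.Perm (Fin (n + 1))} {k : Fin n}
    (hk : σ k.castSucc < σ k.succ) :
    (X (k : ℕ) - X ((k : ℕ) + 1)) * grothendieckNat σ =
      (1 + X ((k : ℕ) + 1)) * grothendieckNat (σ * adjSwap k) -
        (1 + X (k : ℕ)) *
          rename (Equiv.swap (k : ℕ) (k + 1)) (grothendieckNat (σ * adjSwap k)) := by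
  have hX : (1 + X ((k : ℕ) + 1) : MvPolynomial ℕ ℤ) ≠ 0 := fun h => by
    simpa using congrArg constantCoeff h
  have hid (τ : Equiv.Perm (Fin (n + 1))) : grothendieckNat τ = tilingSum n X τ := by
    simpa using (tilingSum_X_comp id τ).symm
  rw [hid, hid, sub_mul_tilingSum hX hk, tilingSum_X_comp, hid]

theorem constantCoeff_grothendieckNat_one :
    constantCoeff (grothendieckNat (1 : Equiv.Perm (Fin (n + 1)))) = 1 := by
  have hempty : (∅ : Finset (Tile n)) ∈ pipeDreams 1 :=
    Finset.mem_filter.2 ⟨Finset.mem_univ _, by simp [strandPerm, crossList]⟩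
  rw [grothendieckNat_eq_sum, map_sum, Finset.sum_eq_single_of_mem ∅ hempty]
  · simp
  · intro D _ hD
    simp [Finset.card_eq_zero.not.2 hD]

theorem strictAnti_strandPerm_univ : StrictAnti (strandPerm (Finset.univ : Finset (Tile n))) := by
  by_contra hanti
  -- Otherwise no tiling has the longest permutation, and all Grothendieck polynomials vanish.
  have hzero (σ : Equiv.Perm (Fin (n + 1))) : grothendieckNat σ = 0 := by
    induction σ using induction_of_first_ascent with
    | longest σ hσ =>
      rw [grothendieckNat_eq_sum]
      refine Finset.sum_eq_zero fun D hD => absurd hσ ?_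
      rw [pipeDreams, Finset.mem_filter] at hD
      rintro hσ
      rw [← hD.2] at hσ
      exact hanti (eq_univ_of_strictAnti_strandPerm hσ ▸ hσ)
    | step σ k hk _ ih =>
      have hdiv := X_sub_X_succ_mul_grothendieckNat hk
      rw [ih, map_zero, mul_zero, mul_zero, sub_zero] at hdiv
      exact (mul_eq_zero.1 hdiv).resolve_left (X_sub_X_succ_ne_zero (k : ℕ))
  simpa [hzero] using constantCoeff_grothendieckNat_one (n := n)

theorem pipeDreams_of_strictAnti {σ : Equiv.Perm (Fin (n + 1))} (hσ : StrictAnti σ) :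
    pipeDreams σ = {Finset.univ} := by
  have huniv : strandPerm (Finset.univ : Finset (Tile n)) = σ := by
    have hrange := (Fin.rev_strictAnti.comp strictAnti_strandPerm_univ).range_inj
      (Fin.rev_strictAnti.comp hσ)
    simp only [Set.range_comp, Equiv.range_eq_univ, true_iff] at hrange
    exact Equiv.ext fun i => Fin.rev_injective (congrFun hrange i)
  ext D
  rw [pipeDreams, Finset.mem_filter, Finset.mem_singleton]
  refine ⟨fun hD => eq_univ_of_strictAnti_strandPerm (hD.2 ▸ hσ), ?_⟩
  rintro rfl
  exact ⟨Finset.mem_univ _, huniv⟩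

theorem prod_tile {M : Type*} [CommMonoid M] (f : ℕ → M) :
    ∏ c : Tile n, f c.1.1 = ∏ i : Fin n, f i ^ (n - i : ℕ) :=
  (Fintype.prod_equiv (tileEquivSigma n) (fun c => f c.1.1) (fun s => f s.1) fun _ => rfl).trans
    (by simp [Fintype.prod_sigma])

theorem grothendieckNat_of_strictAnti {σ : Equiv.Perm (Fin (n + 1))} (hσ : StrictAnti σ) :
    grothendieckNat σ = ∏ i : Fin (n + 1), X (i : ℕ) ^ lehmerCode σ i := by
  rw [grothendieckNat_eq_sum, pipeDreams_of_strictAnti hσ, Finset.sum_singleton,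
    prod_tile X, Fin.prod_univ_castSucc]
  simp [lehmerCode_of_strictAnti hσ]

theorem Avoids132.rename_swap_prod_X_pow_lehmerCode {σ : Equiv.Perm (Fin (n + 1))}
    (hσ : Avoids132 σ) {k : Fin n} (hk : σ k.castSucc < σ k.succ) :
    rename (Equiv.swap (k : ℕ) (k + 1))
        (∏ i : Fin (n + 1), (X (i : ℕ) : MvPolynomial ℕ ℤ) ^ lehmerCode σ i) =
      ∏ i : Fin (n + 1), X (i : ℕ) ^ lehmerCode σ i := by
  have hcode (i : Fin (n + 1)) : lehmerCode σ (adjSwap k i) = lehmerCode σ i := by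
    rw [Equiv.apply_swap_eq_self (hσ.lehmerCode_eq_of_ascent hk)]
  have hval (i : Fin (n + 1)) : Equiv.swap (k : ℕ) (k + 1) i = (adjSwap k i : ℕ) :=
    (Fin.val_injective.map_swap k.castSucc k.succ i).symm
  simp only [map_prod, map_pow, rename_X, hval]
  rw [← Equiv.prod_comp (adjSwap k) fun i => (X (i : ℕ) : MvPolynomial ℕ ℤ) ^ lehmerCode σ i]
  simp only [hcode]

theorem Avoids132.grothendieckNat_eq {σ : Equiv.Perm (Fin (n + 1))} (hσ : Avoids132 σ) :
    grothendieckNat σ = ∏ i : Fin (n + 1), X (i : ℕ) ^ lehmerCode σ i := by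
  induction σ using induction_of_first_ascent with
  | longest σ hanti => exact grothendieckNat_of_strictAnti hanti
  | step σ k hk hfirst ih =>
    have hprod : ∏ i : Fin (n + 1), (X (i : ℕ) : MvPolynomial ℕ ℤ) ^ lehmerCode (σ * adjSwap k) i =
        (∏ i : Fin (n + 1), X (i : ℕ) ^ lehmerCode σ i) * X (k : ℕ) := by
      simp only [hσ.lehmerCode_mul_adjSwap hk, pow_add, Finset.prod_mul_distrib, pow_ite, pow_one,
        pow_zero, Finset.prod_ite_eq', Finset.mem_univ, if_true, Fin.val_castSucc]
    have hdiv := X_sub_X_succ_mul_grothendieckNat hk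
    rw [ih (hσ.mul_adjSwap_of_first_ascent hk hfirst), hprod, map_mul,
      hσ.rename_swap_prod_X_pow_lehmerCode hk, rename_X, Equiv.swap_apply_left] at hdiv
    refine mul_left_cancel₀ (X_sub_X_succ_ne_zero (k : ℕ)) ?_
    rw [hdiv]
    ring

end DividedDifference

section CarryPolynomials

open MvPolynomial

theorem rename_eq_self_of_mem_supported {ι R : Type*} [CommSemiring R] {f : ι → ι} {s : Set ι}
    (hf : ∀ i ∈ s, f i = i) {p : MvPolynomial ι R} (hp : p ∈ supported R s) : rename f p = p := by
  refine AlgHom.adjoin_le_equalizer (rename f) (AlgHom.id R _) ?_ hp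
  rintro _ ⟨i, hi, rfl⟩
  rw [rename_X, hf i hi, AlgHom.id_apply]

theorem sub_mul_sum_ite_le {R : Type*} [CommRing R] (x y : R) {c L : ℕ} (hc : c ≤ L + 1) :
    (x - y) * ∑ p ∈ Finset.range (L + 1), x ^ p * (if c ≤ p then y ^ (L + c - p) else 0) =
      x ^ (L + 1) * y ^ c - x ^ c * y ^ (L + 1) := by
  have hIco : (Finset.range (L + 1)).filter (c ≤ ·) = Finset.Ico c (L + 1) := by
    ext p
    simp [and_comm]
  have hsum : ∑ p ∈ Finset.range (L + 1), x ^ p * (if c ≤ p then y ^ (L + c - p) else 0) =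
      y ^ c * ∑ p ∈ Finset.Ico c (L + 1), x ^ p * y ^ (L + 1 - 1 - p) := by
    rw [← hIco, Finset.sum_filter, Finset.mul_sum]
    refine Finset.sum_congr rfl fun p hp => ?_
    rw [Finset.mem_range] at hp
    split_ifs
    · rw [show L + c - p = c + (L + 1 - 1 - p) by omega, pow_add]
      ring
    · ring
  rw [hsum, mul_left_comm, mul_geom_sum₂_Ico x y hc, mul_sub, mul_left_comm, ← pow_add,
    Nat.add_sub_cancel' hc, mul_comm]

/-- The polynomials in `X_{k+1}, …, X_{k+d}` that describe the Grothendieck polynomials of the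
permutations `insertZero k τ`, where `λ` is the code of `τ` and `d = n - k`: up to the factors
`X_0, …, X_{k-1}` the coefficient of `X_k ^ p` is `carryPoly λ d k p`. Each variable passes the
number `p` on to the next one as a carry `b`. -/
noncomputable def carryPoly (lam : ℕ → ℕ) : ℕ → ℕ → ℕ → MvPolynomial ℕ ℤ
  | 0, _, _ => 1
  | d + 1, k, p => ∑ ε ∈ Finset.range 2, ∑ b ∈ Finset.range (lam (k + 1) + 1),
      if b + ε ≤ p then X (k + 1) ^ (lam k + b + ε - p) * carryPoly lam d (k + 1) b else 0

/-- The generating polynomial of the polynomials `carryPoly λ d k p`. -/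
noncomputable def carrySum (lam : ℕ → ℕ) (d k : ℕ) : MvPolynomial ℕ ℤ :=
  ∑ p ∈ Finset.range (lam k + 1), X k ^ p * carryPoly lam d k p

variable {lam : ℕ → ℕ}

theorem carryPoly_mem_supported (d k p : ℕ) : carryPoly lam d k p ∈ supported ℤ (Set.Ioi k) := by
  induction d generalizing k p with
  | zero => exact one_mem _
  | succ d ih =>
    refine sum_mem fun ε _ => sum_mem fun b _ => ?_
    split_ifs
    · exact mul_mem (pow_mem (X_mem_supported.2 k.lt_succ_self) _)
        (supported_mono (Set.Ioi_subset_Ioi k.le_succ) (ih (k + 1) b))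
    · exact zero_mem _

theorem rename_swap_carryPoly (d k b : ℕ) :
    rename (Equiv.swap k (k + 1)) (carryPoly lam d (k + 1) b) = carryPoly lam d (k + 1) b :=
  rename_eq_self_of_mem_supported
    (fun _ hi => Equiv.swap_apply_of_ne_of_ne (k.lt_succ_self.trans hi).ne' (ne_of_gt hi))
    (carryPoly_mem_supported d (k + 1) b)

theorem carrySum_succ (d k : ℕ) :
    carrySum lam (d + 1) k = ∑ b ∈ Finset.range (lam (k + 1) + 1), carryPoly lam d (k + 1) b *
      ∑ ε ∈ Finset.range 2, ∑ p ∈ Finset.range (lam k + 1),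
        X k ^ p * (if b + ε ≤ p then X (k + 1) ^ (lam k + (b + ε) - p) else 0) := by
  simp only [carrySum, carryPoly, Finset.mul_sum]
  rw [Finset.sum_comm, Finset.sum_congr rfl fun ε _ => Finset.sum_comm, Finset.sum_comm]
  refine Finset.sum_congr rfl fun b _ => Finset.sum_congr rfl fun ε _ =>
    Finset.sum_congr rfl fun p _ => ?_
  rw [add_assoc]
  split_ifs <;> ring

theorem X_sub_X_succ_mul_carrySum {k : ℕ} (hlam : lam (k + 1) ≤ lam k) (d : ℕ) :
    (X k - X (k + 1)) * carrySum lam (d + 1) k =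
      (1 + X (k + 1)) * (X k ^ (lam k + 1) * carrySum lam d (k + 1)) -
        (1 + X k) *
          rename (Equiv.swap k (k + 1)) (X k ^ (lam k + 1) * carrySum lam d (k + 1)) := by
  rw [carrySum_succ]
  simp only [carrySum, map_mul, map_sum, map_pow, rename_X, Equiv.swap_apply_left,
    Equiv.swap_apply_right, rename_swap_carryPoly,
    Finset.mul_sum (s := Finset.range (lam (k + 1) + 1)), ← Finset.sum_sub_distrib]
  refine Finset.sum_congr rfl fun b hb => ?_
  rw [Finset.mem_range] at hb
  rw [mul_left_comm, Finset.mul_sum, Finset.sum_range_succ, Finset.sum_range_one,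
    sub_mul_sum_ite_le _ _ (by omega), sub_mul_sum_ite_le _ _ (by omega)]
  ring

end CarryPolynomials

section InsertZeroGrothendieck

open MvPolynomial

variable {n : ℕ} {τ : Equiv.Perm (Fin n)}

/-- The Lehmer code of a permutation as a sequence, continued by zeros. -/
def extendedCode (τ : Equiv.Perm (Fin n)) (i : ℕ) : ℕ :=
  if h : i < n then lehmerCode τ ⟨i, h⟩ else 0

theorem extendedCode_val (τ : Equiv.Perm (Fin n)) (i : Fin n) :
    extendedCode τ i = lehmerCode τ i :=
  dif_pos i.2

theorem extendedCode_eq_zero (τ : Equiv.Perm (Fin n)) {i : ℕ} (hi : n ≤ i + 1) :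
    extendedCode τ i = 0 := by
  rw [extendedCode]
  split_ifs with h
  · have := lehmerCode_add_val_lt τ ⟨i, h⟩
    simp only at this
    omega
  · rfl

theorem sum_extendedCode (τ : Equiv.Perm (Fin n)) :
    ∑ i ∈ Finset.range n, extendedCode τ i = inversionNumber τ := by
  simp only [Finset.sum_range, extendedCode_val, inversionNumber]

theorem Avoids132.antitone_extendedCode (hτ : Avoids132 τ) : Antitone (extendedCode τ) := by
  intro i j hij
  by_cases hj : j < n
  · rw [extendedCode, extendedCode, dif_pos hj, dif_pos (hij.trans_lt hj)]
    exact hτ.antitone_lehmerCode hij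
  · rw [extendedCode, dif_neg hj]
    exact Nat.zero_le _

theorem Avoids132.grothendieckNat_insertZero_last (hτ : Avoids132 τ) :
    grothendieckNat (insertZero (Fin.last n) τ) =
      ∏ i ∈ Finset.range n, X i ^ (extendedCode τ i + 1) := by
  have hlast := lehmerCode_add_val_lt (insertZero (Fin.last n) τ) (Fin.last n)
  rw [Fin.val_last, Nat.add_comm, Nat.add_lt_add_iff_left, Nat.lt_one_iff] at hlast
  simp only [hτ.insertZero_last.grothendieckNat_eq, Fin.prod_univ_castSucc, hlast, pow_zero,
    mul_one, lehmerCode_insertZero_last_castSucc, Fin.val_castSucc, Finset.prod_range,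
    extendedCode_val]

theorem rename_swap_prod_range (k : ℕ) (e : ℕ → ℕ) :
    rename (Equiv.swap k (k + 1)) (∏ i ∈ Finset.range k, (X i : MvPolynomial ℕ ℤ) ^ e i) =
      ∏ i ∈ Finset.range k, X i ^ e i :=
  rename_eq_self_of_mem_supported (s := Set.Iio k)
    (fun _ hi => Equiv.swap_apply_of_ne_of_ne (ne_of_lt hi) (Nat.lt_succ_of_lt hi).ne)
    (prod_mem fun _ hi => pow_mem (X_mem_supported.2 (Set.mem_Iio.2 (Finset.mem_range.1 hi))) _)

/-- Moving the entry `0` to the left by divided differences, starting from a dominant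
permutation. -/
theorem Avoids132.grothendieckNat_insertZero (hτ : Avoids132 τ) (k : Fin (n + 1)) :
    grothendieckNat (insertZero k τ) = (∏ i ∈ Finset.range k, X i ^ (extendedCode τ i + 1)) *
      carrySum (extendedCode τ) (n - k) k := by
  induction k using Fin.reverseInduction with
  | last =>
    simp [hτ.grothendieckNat_insertZero_last, carrySum, carryPoly,
      extendedCode_eq_zero τ n.le_succ]
  | cast k ih =>
    have hdiv := X_sub_X_succ_mul_grothendieckNat (insertZero_castSucc_lt_succ τ k)
    have hcarry := X_sub_X_succ_mul_carrySum (hτ.antitone_extendedCode (k : ℕ).le_succ)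
      (n - (k + 1))
    rw [insertZero_castSucc_mul_adjSwap, ih, Fin.val_succ, Finset.prod_range_succ, mul_assoc,
      map_mul, rename_swap_prod_range] at hdiv
    rw [Fin.val_castSucc, show n - (k : ℕ) = n - (k + 1) + 1 by omega]
    refine mul_left_cancel₀ (X_sub_X_succ_ne_zero (k : ℕ)) ?_
    linear_combination
      hdiv - (∏ i ∈ Finset.range k, X i ^ (extendedCode τ i + 1)) * hcarry

theorem Avoids132.rename_grothendieckPoly_insertZero_zero (hτ : Avoids132 τ) :
    rename Fin.val (grothendieckPoly (insertZero 0 τ)) = carrySum (extendedCode τ) n 0 := by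
  simpa [grothendieckNat] using hτ.grothendieckNat_insertZero 0

end InsertZeroGrothendieck

section CarryCount

variable {d p : ℕ} {lam a : ℕ → ℕ}

/-- The coefficients of the polynomials `carryPoly`: the number of ways of choosing the carries that
turn a first exponent `p` into the exponents `a 0, …, a (d - 1)` of the following variables. -/
def carryCount : ℕ → (ℕ → ℕ) → (ℕ → ℕ) → ℕ → ℕ
  | 0, _, _, _ => 1
  | d + 1, lam, a, p => ∑ ε ∈ Finset.range 2, ∑ b ∈ Finset.range (lam 1 + 1),
      if b + ε ≤ p ∧ a 0 + p = lam 0 + b + ε then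
        carryCount d (fun i => lam (i + 1)) (fun i => a (i + 1)) b
      else 0

/-- The inequalities on `p, a 0, …, a (d - 1)` that characterize the exponents of nonzero
coefficients. -/
structure CarryFeasible (d : ℕ) (lam a : ℕ → ℕ) (p : ℕ) : Prop where
  le : ∀ i < d, a i ≤ lam i
  sum_le : ∑ j ∈ Finset.range d, lam j ≤ p + ∑ j ∈ Finset.range d, a j
  sum_add_sum_le : ∀ i ≤ d, ∑ j ∈ Finset.range d, lam j + ∑ j ∈ Finset.range i, a j ≤
    ∑ j ∈ Finset.range d, a j + ∑ j ∈ Finset.range (i + 1), lam j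
  add_sum_le : ∀ i ≤ d, p + ∑ j ∈ Finset.range i, a j ≤ ∑ j ∈ Finset.range (i + 1), lam j + i

theorem CarryFeasible.of_succ {ε b : ℕ} (hε : ε < 2) (hb : b + ε ≤ p)
    (ha : a 0 + p = lam 0 + b + ε) (hp : p ≤ lam 0)
    (h : CarryFeasible d (fun i => lam (i + 1)) (fun i => a (i + 1)) b) :
    CarryFeasible (d + 1) lam a p := by
  obtain ⟨hle, hsum, hadd, hcarry⟩ := h
  have hlam (i : ℕ) := Finset.sum_range_succ' lam i
  have hsa (i : ℕ) := Finset.sum_range_succ' a i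
  refine ⟨fun i hi => ?_, ?_, fun i hi => ?_, fun i hi => ?_⟩
  · cases i with
    | zero => omega
    | succ i => exact hle i (by omega)
  · rw [hlam, hsa]
    omega
  · cases i with
    | zero =>
      simp only [hlam, hsa, Finset.sum_range_zero]
      omega
    | succ i =>
      have := hadd i (by omega)
      rw [hlam, hlam, hsa, hsa]
      omega
  · cases i with
    | zero => simpa using hp
    | succ i =>
      have := hcarry i (by omega)
      rw [hlam, hsa]
      omega

theorem CarryFeasible.exists_succ (h : CarryFeasible (d + 1) lam a p) :
    ∃ ε < 2, ∃ b < lam 1 + 1, (b + ε ≤ p ∧ a 0 + p = lam 0 + b + ε) ∧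
      CarryFeasible d (fun i => lam (i + 1)) (fun i => a (i + 1)) b := by
  obtain ⟨hle, hsum, hadd, hcarry⟩ := h
  have hlam (i : ℕ) := Finset.sum_range_succ' lam i
  have hsa (i : ℕ) := Finset.sum_range_succ' a i
  have htail : ∑ j ∈ Finset.range d, a (j + 1) ≤ ∑ j ∈ Finset.range d, lam (j + 1) :=
    Finset.sum_le_sum fun j hj => hle (j + 1) (by simpa using hj)
  have hle_zero := hle 0 d.succ_pos
  have hadd_succ (i : ℕ) (hi : i ≤ d) := hadd (i + 1) (by omega)
  have hcarry_succ (i : ℕ) (hi : i ≤ d) := hcarry (i + 1) (by omega)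
  simp only [hlam, hsa] at hsum hadd_succ hcarry_succ
  have hadd_one := hadd_succ 0 d.zero_le
  have hcarry_one := hcarry_succ 0 d.zero_le
  simp only [Finset.sum_range_zero, Finset.sum_range_one, zero_add] at hadd_one hcarry_one
  -- The bit `ε` is `1` unless `p + a 0 + ⋯ + a d` attains the lower bound `sum_le`.
  obtain ⟨ε, hε, hεsum, hεmin⟩ : ∃ ε < 2,
      ∑ j ∈ Finset.range d, lam (j + 1) + lam 0 + ε ≤
        p + (∑ j ∈ Finset.range d, a (j + 1) + a 0) ∧
      (ε = 0 → p + (∑ j ∈ Finset.range d, a (j + 1) + a 0) =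
        ∑ j ∈ Finset.range d, lam (j + 1) + lam 0) := by
    by_cases hmin : p + (∑ j ∈ Finset.range d, a (j + 1) + a 0) =
        ∑ j ∈ Finset.range d, lam (j + 1) + lam 0
    · exact ⟨0, by omega, by omega, fun _ => hmin⟩
    · exact ⟨1, by omega, by omega, by omega⟩
  refine ⟨ε, hε, a 0 + p - lam 0 - ε, ?_, ⟨by omega, by omega⟩,
    fun i hi => hle (i + 1) (by omega), by omega, fun i hi => ?_, fun i hi => ?_⟩
  · omega
  · have := hadd_succ i hi
    omega
  · have := hadd_succ i hi
    have := hcarry_succ i hi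
    omega

theorem carryCount_pos_iff (hlam : lam d = 0) (hp : p ≤ lam 0) :
    0 < carryCount d lam a p ↔ CarryFeasible d lam a p := by
  induction d generalizing lam a p with
  | zero =>
    have hp : p = 0 := by omega
    exact iff_of_true Nat.one_pos ⟨by simp, by simp, by simp, by simp [hp]⟩
  | succ d ih =>
    have hstep : 0 < carryCount (d + 1) lam a p ↔ ∃ ε < 2, ∃ b < lam 1 + 1,
        (b + ε ≤ p ∧ a 0 + p = lam 0 + b + ε) ∧
          0 < carryCount d (fun i => lam (i + 1)) (fun i => a (i + 1)) b := by
      simp only [carryCount, Finset.sum_pos_iff, Finset.mem_range, Nat.pos_iff_ne_zero, ne_eq,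
        ite_eq_right_iff, Classical.not_imp]
    rw [hstep]
    constructor
    · rintro ⟨ε, hε, b, hb, ⟨hbp, ha⟩, hpos⟩
      exact .of_succ hε hbp ha hp ((ih hlam (Nat.le_of_lt_succ hb)).1 hpos)
    · intro h
      obtain ⟨ε, hε, b, hb, heq, hfeas⟩ := h.exists_succ
      exact ⟨ε, hε, b, hb, heq, (ih hlam (Nat.le_of_lt_succ hb)).2 hfeas⟩

theorem carryCount_le_one (hlam : lam d = 0) (hp : p ≤ lam 0)
    (hsum : p + ∑ j ∈ Finset.range d, a j ≤ ∑ j ∈ Finset.range d, lam j) :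
    carryCount d lam a p ≤ 1 := by
  induction d generalizing lam a p with
  | zero => exact le_rfl
  | succ d ih =>
    rw [Finset.sum_range_succ', Finset.sum_range_succ'] at hsum
    have hone : ∑ b ∈ Finset.range (lam 1 + 1), (if b + 1 ≤ p ∧ a 0 + p = lam 0 + b + 1 then
        carryCount d (fun i => lam (i + 1)) (fun i => a (i + 1)) b else 0) = 0 := by
      refine Finset.sum_eq_zero fun b hb => ite_eq_right_iff.2 fun h => ?_
      by_contra hne
      have := ((carryCount_pos_iff (lam := fun i => lam (i + 1)) hlam
        (Finset.mem_range_succ_iff.1 hb)).1 (Nat.pos_of_ne_zero hne)).sum_le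
      omega
    rw [carryCount, Finset.sum_range_succ, hone, Finset.sum_range_one, add_zero]
    have hb (b : ℕ) (h : b + 0 ≤ p ∧ a 0 + p = lam 0 + b + 0) : b = a 0 + p - lam 0 := by omega
    calc _ ≤ ∑ b ∈ Finset.range (lam 1 + 1), if b = a 0 + p - lam 0 then 1 else 0 := by
          refine Finset.sum_le_sum fun b hmem => ?_
          split_ifs with h h' h'
          · exact ih hlam (Finset.mem_range_succ_iff.1 hmem) (by omega)
          · exact absurd (hb b h) h'
          · exact zero_le_one
          · exact le_rfl
      _ ≤ 1 := by
        rw [Finset.sum_ite_eq']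
        split_ifs <;> simp

end CarryCount

section Coefficients

open MvPolynomial

theorem coeff_X_pow_mul_of_mem_supported {ι R : Type*} [CommSemiring R] {s : Set ι}
    {q : MvPolynomial ι R} (hq : q ∈ supported R s) {k : ι} (hk : k ∉ s) (e : ℕ) (α : ι →₀ ℕ) :
    coeff α (X k ^ e * q) = if α k = e then coeff (α.erase k) q else 0 := by
  classical
  rw [X_pow_eq_monomial, coeff_monomial_mul', one_mul]
  by_cases heq : α k = e
  · have herase : α - Finsupp.single k e = α.erase k := by
      rw [← heq]
      ext j
      by_cases hj : j = k <;> simp [hj]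
    rw [if_pos (Finsupp.single_le_iff.2 heq.ge), if_pos heq, herase]
  · rw [if_neg heq, ite_eq_right_iff]
    intro hle
    by_contra hne
    refine hk (mem_supported.1 hq ((mem_vars_iff_mem_support k).2 ⟨_, mem_support_iff.2 hne, ?_⟩))
    rw [Finsupp.mem_support_iff, Finsupp.tsub_apply, Finsupp.single_eq_same]
    exact Nat.sub_ne_zero_of_lt ((Finsupp.single_le_iff.1 hle).lt_of_ne' heq)

variable {lam : ℕ → ℕ}

theorem coeff_X_pow_mul_carryPoly (d k p e : ℕ) (α : ℕ →₀ ℕ) :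
    coeff α (X k ^ e * carryPoly lam d k p) =
      if α k = e then coeff (α.erase k) (carryPoly lam d k p) else 0 :=
  coeff_X_pow_mul_of_mem_supported (carryPoly_mem_supported d k p) (lt_irrefl k) e α

theorem coeff_carryPoly {d k p : ℕ} {α : ℕ →₀ ℕ} (hp : p ≤ lam k)
    (hα : ∀ i, α i ≠ 0 → i ∈ Set.Ioc k (k + d)) :
    coeff α (carryPoly lam d k p) =
      carryCount d (fun i => lam (k + i)) (fun i => α (k + 1 + i)) p := by
  induction d generalizing k p α with
  | zero =>
    have : α = 0 := Finsupp.ext fun i => by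
      by_contra h
      simpa using hα i h
    simp [carryPoly, carryCount, this]
  | succ d ih =>
    simp only [carryPoly, carryCount, coeff_sum, Nat.cast_sum]
    refine Finset.sum_congr rfl fun ε _ => Finset.sum_congr rfl fun b hb => ?_
    have hsupp (i : ℕ) (hi : α.erase (k + 1) i ≠ 0) : i ∈ Set.Ioc (k + 1) (k + 1 + d) := by
      obtain ⟨hne, hi⟩ : i ≠ k + 1 ∧ α i ≠ 0 := by
        simpa [Finsupp.erase_apply, and_comm] using hi
      have := Set.mem_Ioc.1 (hα i hi)
      exact Set.mem_Ioc.2 (by omega)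
    have hexp (i : ℕ) : α.erase (k + 1) (k + 1 + 1 + i) = α (k + 1 + (i + 1)) := by
      rw [Finsupp.erase_ne (by omega)]
      congr 1
      omega
    have hcode (i : ℕ) : lam (k + 1 + i) = lam (k + (i + 1)) := by
      congr 1
      omega
    have hiff : b + ε ≤ p ∧ α (k + 1 + 0) + p = lam (k + 0) + b + ε ↔
        b + ε ≤ p ∧ α (k + 1) = lam k + b + ε - p := by
      rw [add_zero, add_zero]
      omega
    rw [if_congr hiff rfl rfl]
    split_ifs with hbε h h
    · rw [coeff_X_pow_mul_carryPoly, if_pos h.2, ih (Finset.mem_range_succ_iff.1 hb) hsupp]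
      simp only [hexp, hcode]
    · rw [coeff_X_pow_mul_carryPoly, if_neg fun heq => h ⟨hbε, heq⟩, Nat.cast_zero]
    · exact absurd h.1 hbε
    · rfl

/-- The exponents of a monomial in `t_0, …, t_{n-1}` as a sequence, continued by zeros. -/
noncomputable def extendedExponent {n : ℕ} (α : Fin n →₀ ℕ) : ℕ →₀ ℕ :=
  α.mapDomain Fin.val

theorem extendedExponent_val {n : ℕ} (α : Fin n →₀ ℕ) (i : Fin n) : extendedExponent α i = α i :=
  Finsupp.mapDomain_apply Fin.val_injective α i

theorem extendedExponent_eq_zero {n : ℕ} (α : Fin n →₀ ℕ) {i : ℕ} (hi : n ≤ i) :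
    extendedExponent α i = 0 :=
  Finsupp.mapDomain_of_notMem_range α i fun ⟨j, hj⟩ => (hj ▸ j.2).not_ge hi

theorem Avoids132.coeff_grothendieckPoly_insertZero_zero {n : ℕ} {τ : Equiv.Perm (Fin n)}
    (hτ : Avoids132 τ) (α : Fin n →₀ ℕ) :
    coeff α (grothendieckPoly (insertZero 0 τ)) =
      if extendedExponent α 0 ≤ extendedCode τ 0 then
        (carryCount n (extendedCode τ) (fun i => extendedExponent α (i + 1))
          (extendedExponent α 0) : ℤ)
      else 0 := by
  have hsupp (i : ℕ) (hi : (extendedExponent α).erase 0 i ≠ 0) : i ∈ Set.Ioc 0 (0 + n) := by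
    obtain ⟨hne, hi⟩ : i ≠ 0 ∧ extendedExponent α i ≠ 0 := by
      simpa [Finsupp.erase_apply, and_comm] using hi
    exact ⟨Nat.pos_of_ne_zero hne, by
      by_contra! h
      exact hi (extendedExponent_eq_zero α (by omega))⟩
  rw [← coeff_rename_mapDomain Fin.val Fin.val_injective,
    hτ.rename_grothendieckPoly_insertZero_zero, ← extendedExponent, carrySum, coeff_sum]
  simp only [coeff_X_pow_mul_carryPoly, Finset.sum_ite_eq, Finset.mem_range_succ_iff]
  refine ite_congr rfl (fun hle => ?_) fun _ => rfl
  have hexp (i : ℕ) : (extendedExponent α).erase 0 (0 + 1 + i) = extendedExponent α (i + 1) := by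
    rw [Finsupp.erase_ne (by omega), zero_add, add_comm]
  simp only [coeff_carryPoly hle hsupp, hexp, zero_add]

end Coefficients

section SupportRegion

variable {n : ℕ} {lam : ℕ → ℕ}

/-- The inequalities that describe the exponents of the Grothendieck polynomial of `insertZero 0 τ`,
where `λ` is the code of `τ`. The upper bound on the first coordinate is `λ 0`, because the
subtraction is truncated. -/
structure MemSupportRegion {𝕜 : Type*} [CommRing 𝕜] [LinearOrder 𝕜] (lam : ℕ → ℕ) (t : Fin n → 𝕜) :
    Prop where
  le (i : Fin n) : t i ≤ lam (i - 1)
  sum_add_prefixSum_le {k : ℕ} (hk : k ≤ n) : ((∑ j ∈ Finset.range n, lam j : ℕ) : 𝕜) +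
    prefixSum t k ≤ ∑ i, t i + (∑ j ∈ Finset.range k, lam j : ℕ)
  prefixSum_le {k : ℕ} (hk : k ≤ n) :
    prefixSum t k ≤ (∑ j ∈ Finset.range k, lam j + (k - 1) : ℕ)

theorem memSupportRegion_intCast_iff {p : Fin n → ℤ} :
    MemSupportRegion lam (fun i => (p i : ℝ)) ↔ MemSupportRegion lam p := by
  have hsum : ∑ i, (p i : ℝ) = (∑ i, p i : ℤ) := (Int.cast_sum _ _).symm
  have hprefix (k : ℕ) : prefixSum (fun i => (p i : ℝ)) k = (prefixSum p k : ℤ) :=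
    (Int.cast_sum _ _).symm
  constructor <;> rintro ⟨hle, hadd, hprefix_le⟩ <;> constructor
  all_goals
    simp only [hsum, hprefix] at *
    assumption_mod_cast

theorem convex_memSupportRegion (lam : ℕ → ℕ) :
    Convex ℝ {t : Fin n → ℝ | MemSupportRegion lam t} := by
  intro x hx y hy a b ha hb hab
  have hsum (I : Finset (Fin n)) : ∑ i ∈ I, (a • x + b • y) i =
      a * ∑ i ∈ I, x i + b * ∑ i ∈ I, y i := by
    simp [Finset.sum_add_distrib, Finset.mul_sum]
  have hcomb {u u' v v' : ℝ} (hu : u ≤ u') (hv : v ≤ v') : a * u + b * v ≤ a * u' + b * v' :=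
    add_le_add (mul_le_mul_of_nonneg_left hu ha) (mul_le_mul_of_nonneg_left hv hb)
  have hconst (c : ℝ) : a * c + b * c = c := by rw [← add_mul, hab, one_mul]
  refine ⟨fun i => ?_, fun {k} hk => ?_, fun {k} hk => ?_⟩
  · exact (hcomb (hx.le i) (hy.le i)).trans_eq (hconst _)
  · have := hcomb (hx.sum_add_prefixSum_le hk) (hy.sum_add_prefixSum_le hk)
    simp only [prefixSum, hsum, mul_add] at this ⊢
    linarith [hconst (∑ j ∈ Finset.range n, lam j : ℕ), hconst (∑ j ∈ Finset.range k, lam j : ℕ)]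
  · simp only [prefixSum, hsum]
    exact (hcomb (hx.prefixSum_le hk) (hy.prefixSum_le hk)).trans_eq (hconst _)

theorem MemSupportRegion.sum_add_le {p : Fin (n + 1) → ℤ} (hp : MemSupportRegion lam p)
    (i : Fin (n + 1)) : ∑ j, p j + (∑ j ∈ Finset.range i, lam j : ℕ) ≤
      prefixSum p (i + 1) + (∑ j ∈ Finset.range n, lam j : ℕ) := by
  induction i using Fin.reverseInduction with
  | last => rw [Fin.val_last, prefixSum_self]
  | cast i ih =>
    have hstep := prefixSum_succ p i.succ
    have hle := hp.le i.succ
    rw [Fin.val_succ, Finset.sum_range_succ] at ih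
    simp only [Fin.val_succ, Nat.add_sub_cancel] at hle hstep
    rw [Fin.val_castSucc]
    push_cast at *
    linarith

theorem MemSupportRegion.nonneg {p : Fin n → ℤ} (hp : MemSupportRegion lam p)
    (hlam : lam (n - 1) = 0) (i : Fin n) : 0 ≤ p i := by
  obtain ⟨n, rfl⟩ : ∃ m, n = m + 1 := ⟨n - 1, by have := i.pos; omega⟩
  have hlower := hp.sum_add_prefixSum_le i.is_lt.le
  have hupper := hp.sum_add_le i
  rw [Nat.add_sub_cancel] at hlam
  rw [Finset.sum_range_succ, hlam, add_zero] at hlower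
  rw [prefixSum_succ] at hupper
  linarith

theorem memSupportRegion_and_sum_eq_iff {p : Fin n → ℤ} {s : ℤ} :
    MemSupportRegion lam p ∧ ∑ i, p i = s ↔ MemBoxChain (fun i : Fin n => (lam (i - 1) : ℤ))
      (fun k => (∑ j ∈ Finset.range k, lam j : ℕ) +
        min (s - (∑ j ∈ Finset.range n, lam j : ℕ)) (k - 1 : ℕ)) s p := by
  constructor
  · rintro ⟨hp, rfl⟩
    refine ⟨hp.le, fun {k} hk => ?_, rfl⟩
    have := hp.sum_add_prefixSum_le hk
    have := hp.prefixSum_le hk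
    omega
  · rintro ⟨hle, hchain, rfl⟩
    refine ⟨⟨hle, fun {k} hk => ?_, fun {k} hk => ?_⟩, rfl⟩
    all_goals
      have := hchain hk
      omega

theorem memSupportRegion_self (hlam : Antitone lam) :
    MemSupportRegion lam (fun i : Fin n => (lam i : ℤ)) := by
  have hsum : ∑ i : Fin n, (lam i : ℤ) = (∑ j ∈ Finset.range n, lam j : ℕ) := by
    rw [Nat.cast_sum, Finset.sum_range]
  have hprefix {k : ℕ} (hk : k ≤ n) :
      prefixSum (fun i : Fin n => (lam i : ℤ)) k = (∑ j ∈ Finset.range k, lam j : ℕ) := by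
    rw [prefixSum_eq_sum_range (fun j => (lam j : ℤ)) hk, Nat.cast_sum]
  refine ⟨fun i => ?_, fun {k} hk => ?_, fun {k} hk => ?_⟩
  · exact_mod_cast hlam (Nat.sub_le i 1)
  · rw [hsum, hprefix hk]
  · rw [hprefix hk]
    exact_mod_cast Nat.le_add_right _ _

theorem memSupportRegion_iff_extendedExponent (α : Fin n →₀ ℕ) :
    MemSupportRegion lam (fun i => (α i : ℤ)) ↔
      (∀ i < n, extendedExponent α i ≤ lam (i - 1)) ∧
      (∀ k ≤ n, ∑ j ∈ Finset.range n, lam j + ∑ j ∈ Finset.range k, extendedExponent α j ≤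
        ∑ j ∈ Finset.range n, extendedExponent α j + ∑ j ∈ Finset.range k, lam j) ∧
      ∀ k ≤ n, ∑ j ∈ Finset.range k, extendedExponent α j ≤
        ∑ j ∈ Finset.range k, lam j + (k - 1) := by
  have hprefix {k : ℕ} (hk : k ≤ n) : prefixSum (fun i => (α i : ℤ)) k =
      (∑ j ∈ Finset.range k, extendedExponent α j : ℕ) := by
    simp only [← extendedExponent_val α]
    rw [prefixSum_eq_sum_range (fun j => (extendedExponent α j : ℤ)) hk, Nat.cast_sum]
  have hsum : ∑ i, (α i : ℤ) = (∑ j ∈ Finset.range n, extendedExponent α j : ℕ) := by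
    rw [← prefixSum_self, hprefix le_rfl]
  constructor
  · rintro ⟨hle, hadd, hprefix_le⟩
    refine ⟨fun i hi => ?_, fun k hk => ?_, fun k hk => ?_⟩
    · rw [extendedExponent_val α ⟨i, hi⟩]
      exact_mod_cast hle ⟨i, hi⟩
    · have := hadd hk
      rw [hprefix hk, hsum] at this
      exact_mod_cast this
    · have := hprefix_le hk
      rw [hprefix hk] at this
      exact_mod_cast this
  · rintro ⟨hle, hadd, hprefix_le⟩
    refine ⟨fun i => ?_, fun {k} hk => ?_, fun {k} hk => ?_⟩
    · rw [← extendedExponent_val α]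
      exact_mod_cast hle i i.2
    · rw [hprefix hk, hsum]
      exact_mod_cast hadd k hk
    · rw [hprefix hk]
      exact_mod_cast hprefix_le k hk

theorem carryFeasible_iff_memSupportRegion (hlam : ∀ i, n ≤ i + 1 → lam i = 0) (α : Fin n →₀ ℕ) :
    CarryFeasible n lam (fun i => extendedExponent α (i + 1)) (extendedExponent α 0) ↔
      MemSupportRegion lam (fun i => (α i : ℤ)) := by
  rw [memSupportRegion_iff_extendedExponent]
  have hzero : extendedExponent α n = 0 := extendedExponent_eq_zero α le_rfl
  have htail (k : ℕ) := Finset.sum_range_succ' (extendedExponent α) k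
  have htotal := Finset.sum_range_succ (extendedExponent α) n
  have htail_n := htail n
  have hlast := Finset.sum_range_succ lam n
  constructor
  · rintro ⟨hle, hsum_le, hadd, hadd_le⟩
    refine ⟨fun i hi => ?_, fun k hk => ?_, fun k hk => ?_⟩
    · rcases i with _ | i
      · simpa using hadd_le 0 (Nat.zero_le n)
      · exact hle i (by omega)
    all_goals rcases k with _ | k
    · simp only [Finset.range_zero, Finset.sum_empty]
      omega
    · linarith [hadd k (by omega), htail k]
    · simp
    · have := hadd_le k (by omega)
      have := htail k
      omega
  · rintro ⟨hle, hadd, hprefix_le⟩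
    refine ⟨fun i hi => ?_, ?_, fun i hi => ?_, fun i hi => ?_⟩
    · rcases (Nat.succ_le_of_lt hi).lt_or_eq with hi | rfl
      · exact hle (i + 1) hi
      · exact hzero.trans_le (Nat.zero_le _)
    · have := hadd 0 (Nat.zero_le n)
      simp only [Finset.range_zero, Finset.sum_empty] at this
      omega
    all_goals rcases hi.lt_or_eq with hi | rfl
    · linarith [hadd (i + 1) hi, htail i]
    · omega
    · have := hprefix_le (i + 1) hi
      have := htail i
      omega
    · linarith [hprefix_le i le_rfl, Nat.sub_le i 1]

end SupportRegion

section Support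

open MvPolynomial

variable {n : ℕ} {f : MvPolynomial (Fin n) ℤ}

/-- The exponent vectors of the monomials that appear in `f`, as points of the lattice `ℤⁿ`. -/
def latticeSupport (f : MvPolynomial (Fin n) ℤ) : Set (Fin n → ℤ) :=
  {p | ∃ α : Fin n →₀ ℕ, f.coeff α ≠ 0 ∧ p = fun i => (α i : ℤ)}

theorem natCast_exponent_injective :
    Function.Injective fun (α : Fin n →₀ ℕ) (i : Fin n) => (α i : ℤ) :=
  fun _ _ h => Finsupp.ext fun i => Nat.cast_injective (congrFun h i)

theorem natCast_mem_latticeSupport {α : Fin n →₀ ℕ} :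
    (fun i => (α i : ℤ)) ∈ latticeSupport f ↔ f.coeff α ≠ 0 := by
  refine ⟨?_, fun h => ⟨α, h, rfl⟩⟩
  rintro ⟨β, hβ, heq⟩
  rwa [natCast_exponent_injective heq]

theorem coe_image_support_eq_latticeSupport [DecidableEq (Fin n → ℤ)] :
    ↑(f.support.image fun (α : Fin n →₀ ℕ) (i : Fin n) => (α i : ℤ)) = latticeSupport f := by
  ext p
  simp only [latticeSupport, Finset.coe_image, Set.mem_image, Finset.mem_coe, mem_support_iff,
    Set.mem_ofPred_eq, eq_comm]

theorem exponentVectors_eq_image_latticeSupport :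
    exponentVectors f = (fun (p : Fin n → ℤ) (i : Fin n) => (p i : ℝ)) '' latticeSupport f := by
  ext x
  constructor
  · rintro ⟨α, hα, rfl⟩
    exact ⟨_, ⟨α, hα, rfl⟩, by simp⟩
  · rintro ⟨_, ⟨α, hα, rfl⟩, rfl⟩
    exact ⟨α, hα, by simp⟩

theorem hasPolytopalSupport_of_convex {Q : Set (Fin n → ℝ)} (hQ : Convex ℝ Q)
    (h : integerPoints Q = latticeSupport f) : HasPolytopalSupport f := by
  have hsub : exponentVectors f ⊆ Q := by
    rw [exponentVectors_eq_image_latticeSupport, ← h]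
    exact Set.image_subset_iff.2 fun p hp => hp
  refine Set.Subset.antisymm (fun p hp => h.subset (convexHull_min hsub hQ hp)) fun p hp => ?_
  refine subset_convexHull ℝ _ ?_
  rw [exponentVectors_eq_image_latticeSupport]
  exact Set.mem_image_of_mem _ hp

theorem mem_latticeSupport_homogeneousComponent {d : ℕ} {p : Fin n → ℤ} :
    p ∈ latticeSupport (homogeneousComponent d f) ↔ p ∈ latticeSupport f ∧ ∑ i, p i = d := by
  have hdegree (α : Fin n →₀ ℕ) : ∑ i, (α i : ℤ) = d ↔ α.degree = d := by
    rw [Finsupp.degree_eq_sum]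
    norm_cast
  constructor
  · rintro ⟨α, hα, rfl⟩
    rw [coeff_homogeneousComponent, ite_ne_right_iff] at hα
    exact ⟨⟨α, hα.2, rfl⟩, (hdegree α).2 hα.1⟩
  · rintro ⟨⟨α, hα, rfl⟩, hsum⟩
    rw [natCast_mem_latticeSupport, coeff_homogeneousComponent, if_pos ((hdegree α).1 hsum)]
    exact hα

theorem HasPolytopalSupport.homogeneousComponent (hf : HasPolytopalSupport f) (d : ℕ) :
    HasPolytopalSupport (homogeneousComponent d f) := by
  have hplane : Convex ℝ {t : Fin n → ℝ | ∑ i, t i = d} :=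
    convex_hyperplane (f := fun t : Fin n → ℝ => ∑ i, t i)
      ⟨fun x y => Finset.sum_add_distrib, fun c x => (Finset.mul_sum _ _ _).symm⟩ d
  refine hasPolytopalSupport_of_convex (Q := newtonPolytope f ∩ {t | ∑ i, t i = d})
    ((convex_convexHull ℝ _).inter hplane) ?_
  ext p
  have hsum : ∑ i, (p i : ℝ) = d ↔ ∑ i, p i = d := by norm_cast
  rw [mem_latticeSupport_homogeneousComponent, ← hsum]
  exact and_congr_left fun _ => Set.ext_iff.1 hf p

theorem isGeneralizedPermutahedron_newtonPolytope {u : Fin n → ℤ} {c : ℕ → ℤ} {s : ℤ} (hf : f ≠ 0)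
    (h : ∀ p, p ∈ latticeSupport f ↔ MemBoxChain u c s p) :
    IsGeneralizedPermutahedron (newtonPolytope f) := by
  classical
  set A : Finset (Fin n → ℤ) := f.support.image fun α i => (α i : ℤ)
  have hcoe : ↑A = latticeSupport f := coe_image_support_eq_latticeSupport
  have hA (p : Fin n → ℤ) : p ∈ A ↔ MemBoxChain u c s p := by rw [← h, ← hcoe, Finset.mem_coe]
  have hhull : newtonPolytope f = integerHull A := by
    rw [newtonPolytope, exponentVectors_eq_image_latticeSupport, ← hcoe, integerHull]
  rw [hhull]
  exact (symmetricExchange_of_memBoxChain hA).isGeneralizedPermutahedron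
    ((support_nonempty.2 hf).image _) fun p hp => ((hA p).1 hp).sum_eq

theorem isIntegerPointTransform_newtonPolytope (hf : HasPolytopalSupport f)
    (h1 : ∀ α, f.coeff α ≠ 0 → f.coeff α = 1) :
    IsIntegerPointTransform f (newtonPolytope f) := by
  classical
  have hpoints : integerPoints (newtonPolytope f) =
      ↑(f.support.image fun (α : Fin n →₀ ℕ) (i : Fin n) => (α i : ℤ)) :=
    hf.trans coe_image_support_eq_latticeSupport.symm
  have hfin : (integerPoints (newtonPolytope f)).Finite := hpoints ▸ Finset.finite_toSet _
  refine ⟨hfin, ?_⟩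
  have himage : hfin.toFinset = f.support.image fun (α : Fin n →₀ ℕ) (i : Fin n) => (α i : ℤ) := by
    rw [← Finset.coe_inj, Set.Finite.coe_toFinset, hpoints]
  rw [himage, Finset.sum_image natCast_exponent_injective.injOn, toLaurent]
  exact Finset.sum_congr rfl fun α hα => by rw [h1 α (mem_support_iff.1 hα)]

theorem schubertPoly_eq_homogeneousComponent (π : Equiv.Perm (Fin (n + 1))) :
    schubertPoly π = homogeneousComponent (inversionNumber π) (grothendieckPoly π) := by
  classical
  rw [schubertPoly, grothendieckPoly, map_sum, reducedPipeDreams, Finset.sum_filter]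
  refine Finset.sum_congr rfl fun D hD => ?_
  have hhom : (pipeWeight D).IsHomogeneous D.card := by
    simpa [pipeWeight] using IsHomogeneous.prod D (fun c : Tile n => (X c.1.1 : MvPolynomial _ ℤ))
      (fun _ => 1) fun c _ => isHomogeneous_X _ _
  rw [homogeneousComponent_of_mem hhom]
  exact if_congr (by rw [isReducedTiling_iff, (Finset.mem_filter.1 hD).2, eq_comm]) rfl rfl

end Support

section Dominant

open MvPolynomial

variable {n : ℕ} {τ : Equiv.Perm (Fin n)}

theorem Avoids132.coeff_grothendieckPoly_ne_zero_iff (hτ : Avoids132 τ) (α : Fin n →₀ ℕ) :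
    coeff α (grothendieckPoly (insertZero 0 τ)) ≠ 0 ↔
      MemSupportRegion (extendedCode τ) (fun i => (α i : ℤ)) := by
  have hzero (i : ℕ) (hi : n ≤ i + 1) : extendedCode τ i = 0 := extendedCode_eq_zero τ hi
  rw [hτ.coeff_grothendieckPoly_insertZero_zero, ← carryFeasible_iff_memSupportRegion hzero]
  split_ifs with hle
  · rw [Nat.cast_ne_zero, ← Nat.pos_iff_ne_zero, carryCount_pos_iff (hzero n n.le_succ) hle]
  · exact iff_of_false (not_ne_iff.2 rfl) fun h => hle (by simpa using h.add_sum_le 0 n.zero_le)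

theorem Avoids132.mem_latticeSupport_grothendieckPoly_iff (hτ : Avoids132 τ) {p : Fin n → ℤ} :
    p ∈ latticeSupport (grothendieckPoly (insertZero 0 τ)) ↔
      MemSupportRegion (extendedCode τ) p := by
  constructor
  · rintro ⟨α, hα, rfl⟩
    exact (hτ.coeff_grothendieckPoly_ne_zero_iff α).1 hα
  · intro hp
    have hnonneg := hp.nonneg (extendedCode_eq_zero τ (by omega))
    lift p to Fin n → ℕ using hnonneg
    have := (hτ.coeff_grothendieckPoly_ne_zero_iff (Finsupp.equivFunOnFinite.symm p)).2 hp
    exact natCast_mem_latticeSupport.2 this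

theorem Avoids132.hasPolytopalSupport_grothendieckPoly (hτ : Avoids132 τ) :
    HasPolytopalSupport (grothendieckPoly (insertZero 0 τ)) := by
  refine hasPolytopalSupport_of_convex (convex_memSupportRegion (extendedCode τ)) ?_
  ext p
  rw [hτ.mem_latticeSupport_grothendieckPoly_iff, ← memSupportRegion_intCast_iff]
  rfl

theorem Avoids132.isGeneralizedPermutahedron_newtonPolytope_homogeneousComponent
    (hτ : Avoids132 τ) {d : ℕ}
    (hd : homogeneousComponent d (grothendieckPoly (insertZero 0 τ)) ≠ 0) :
    IsGeneralizedPermutahedron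
      (newtonPolytope (homogeneousComponent d (grothendieckPoly (insertZero 0 τ)))) :=
  isGeneralizedPermutahedron_newtonPolytope hd fun p => by
    rw [mem_latticeSupport_homogeneousComponent, hτ.mem_latticeSupport_grothendieckPoly_iff,
      memSupportRegion_and_sum_eq_iff]

theorem Avoids132.schubertPoly_ne_zero (hτ : Avoids132 τ) :
    schubertPoly (insertZero 0 τ) ≠ 0 := by
  have hsum : ∑ i : Fin n, (extendedCode τ i : ℤ) = inversionNumber (insertZero 0 τ) := by
    rw [inversionNumber_insertZero_zero, ← sum_extendedCode, Finset.sum_range, Nat.cast_sum]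
  have hmem : (fun i : Fin n => (extendedCode τ i : ℤ)) ∈
      latticeSupport (schubertPoly (insertZero 0 τ)) := by
    rw [schubertPoly_eq_homogeneousComponent, mem_latticeSupport_homogeneousComponent,
      hτ.mem_latticeSupport_grothendieckPoly_iff]
    exact ⟨memSupportRegion_self hτ.antitone_extendedCode, hsum⟩
  intro hzero
  obtain ⟨α, hα, -⟩ := hmem
  exact hα (by rw [hzero, coeff_zero])

theorem Avoids132.coeff_schubertPoly_eq_one (hτ : Avoids132 τ) {α : Fin n →₀ ℕ}
    (hα : coeff α (schubertPoly (insertZero 0 τ)) ≠ 0) :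
    coeff α (schubertPoly (insertZero 0 τ)) = 1 := by
  rw [schubertPoly_eq_homogeneousComponent, coeff_homogeneousComponent,
    hτ.coeff_grothendieckPoly_insertZero_zero] at hα ⊢
  obtain ⟨hdegree, hle, hcount⟩ := by simpa only [ite_ne_right_iff] using hα
  rw [if_pos hdegree, if_pos hle]
  have hsum : extendedExponent α 0 + ∑ j ∈ Finset.range n, extendedExponent α (j + 1) =
      ∑ j ∈ Finset.range n, extendedCode τ j := by
    rw [add_comm, ← Finset.sum_range_succ', Finset.sum_range_succ,
      extendedExponent_eq_zero α le_rfl, add_zero, Finset.sum_range, sum_extendedCode,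
      ← inversionNumber_insertZero_zero, ← hdegree, Finsupp.degree_eq_sum]
    simp only [extendedExponent_val]
  have hone := carryCount_le_one (extendedCode_eq_zero τ n.le_succ) hle hsum.le
  have hpos := Nat.pos_of_ne_zero (Nat.cast_ne_zero.1 hcount)
  rw [hone.antisymm hpos, Nat.cast_one]

end Dominant

theorem eq_insertZero_zero {n : ℕ} {π : Equiv.Perm (Fin (n + 1))} {π' : Equiv.Perm (Fin n)}
    (hfirst : π 0 = 0) (hrest : ∀ i : Fin n, π i.succ = (π' i).succ) :
    π = insertZero 0 π' :=
  Equiv.ext (Fin.cases (by rw [hfirst, insertZero_self]) fun i => by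
    rw [hrest, insertZero_zero_succ])

theorem theoremC (n : ℕ) (π : Equiv.Perm (Fin (n + 1))) (π' : Equiv.Perm (Fin n))
    (hfirst : π 0 = 0) (hrest : ∀ i : Fin n, π i.succ = (π' i).succ)
    (hdom : IsDominantPerm π') :
    (HasPolytopalSupport (grothendieckPoly π) ∧
      ∀ d : ℕ, MvPolynomial.homogeneousComponent d (grothendieckPoly π) ≠ 0 →
        IsGeneralizedPermutahedron
          (newtonPolytope (MvPolynomial.homogeneousComponent d (grothendieckPoly π)))) ∧
    (HasPolytopalSupport (schubertPoly π) ∧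
      IsGeneralizedPermutahedron (newtonPolytope (schubertPoly π)) ∧
      IsIntegerPointTransform (schubertPoly π) (newtonPolytope (schubertPoly π))) := by
  obtain rfl := eq_insertZero_zero hfirst hrest
  have h132 : Avoids132 π' := hdom.avoids132
  have hschubert := schubertPoly_eq_homogeneousComponent (insertZero 0 π')
  have hG : HasPolytopalSupport (grothendieckPoly (insertZero 0 π')) :=
    h132.hasPolytopalSupport_grothendieckPoly
  have hS : HasPolytopalSupport (schubertPoly (insertZero 0 π')) :=
    hschubert ▸ hG.homogeneousComponent _
  have hS_perm : IsGeneralizedPermutahedron (newtonPolytope (schubertPoly (insertZero 0 π'))) := by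
    have hne := h132.schubertPoly_ne_zero
    rw [hschubert] at hne ⊢
    exact h132.isGeneralizedPermutahedron_newtonPolytope_homogeneousComponent hne
  exact ⟨⟨hG, fun _ => h132.isGeneralizedPermutahedron_newtonPolytope_homogeneousComponent⟩,
    hS, hS_perm,
    isIntegerPointTransform_newtonPolytope hS fun _ => h132.coeff_schubertPoly_eq_one⟩
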